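/- **Definitions.** A nondeterministic integral discounted-sum automaton (NDA) is a tuple $\mathcal A=(\Sigma,Q,Q_0,\alpha,\delta,\mathrm{val},\mathrm{fval},\lambda)$ with a finite alphabet $\Sigma$, a finite set $Q$ of states, $Q_0\subseteq Q$ initial states, $\alpha\subseteq Q$ accepting states, a (not necessarily total) transition relation $\delta\subseteq Q\times\Sigma\times Q$, weights $\mathrm{val}:\delta\to\mathbb N$ and $\mathrm{fval}:\alpha\to\mathbb N$, and an integer discount factor $\lambda>1$. A run $\rho_0\cdots\rho_n$ on $w=w_1\cdots w_n$ (with $(\rho_{i},w_{i+1},\rho_{i+1})\in\delta$ for $0\le i<n$) has weight $\sum_{i=0}^{n-1}\lambda^{-i}\,\mathrm{val}(\rho_i,w_{i+1},\rho_{i+1})$. For $P,P'\subseteq Q$ let $\mathcal A_{[P\to P']}(w)$ be the minimal weight of a run on $w$ from $P$ to $P'$, and let $\mathcal A_{[P\to_f P']}(w)$ be the minimum of weight plus $\lambda^{-n}\,\mathrm{fval}(\rho_n)$ over the runs on $w$ from $P$ to $P'$ that end in an accepting state; both are $\infty$ if there is no such run, and a singleton $\{q\}$ is written $q$. The value of $w$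 is $\mathcal A^*(w)=\mathcal A_{[Q_0\to_f\alpha]}(w)$. Two NDAs over $\Sigma$ are equivalent if they give every word the same value. An NDA is deterministic (a DDA) if $|Q_0|=1$ and each state has at most one $\sigma$-successor for every letter $\sigma$; $\mathcal A$ is determinizable if it is equivalent to some DDA. A triple $(w,q_u,q_l)$ is a recoverable gap with respect to $z\in\Sigma^*$ if $\mathcal A_{[Q_0\to q_l]}(w)\le\mathcal A_{[Q_0\to q_u]}(w)$ and $\mathcal A_{[Q_0\to q_u]}(w)+\lambda^{-|w|}\mathcal A_{[q_u\to_f\alpha]}(z)=\mathcal A^*(wz)<\infty$. For real $n$, the word $w$ has the $n$-separation property with respect to the suffix $z$ if there are a partition of $Q$ into two non-empty sets $U,L$ and a state $q_u\in U$ such that $\lambda^{|w|}(\mathcal A_{[Q_0\to u]}(w)-\mathcal A_{[Q_0\to l]}(w))>n$ for all $u\in U$, $l\in L$, and $(w,q_u,l)$ is a recoverable gap with respect to $z$ for every $l\in L$. Let $m_{\mathcal A}$ be the maximal transition or final weight of $\mathcal A$ (and $0$ if there is none), $\mathcal M=\frac{2\lambda}{\lambda-1}m_{\mathcal A}$, and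 $$\mathcal N=\lambda^{|Q|^2 2^{|Q|^2}}\bigl((|Q|-1)\mathcal M+\mathcal M\bigr)-\mathcal M .$$ Say that $\mathcal A$ has a short separation if some word $w$ with $|w|\le\bigl(\frac{\lambda}{\lambda-1}(\mathcal N|Q|+2m_{\mathcal A})+2\bigr)^{|Q|}$ has the $\mathcal N$-separation property with respect to some $z$ with $|z|\le 2^{2|Q|}$. **Theorem.** 1. It is decidable whether a given NDA is determinizable: there is a computable function that, given the tables describing an NDA (with letters $0,\dots,k-1$ and states $0,\dots,n-1$), decides whether it has an equivalent DDA. 2. For every NDA $\mathcal A$: (a) there are only finitely many pairs $(w,z)$ of words that satisfy the two length bounds; (b) if every state reachable from $Q_0$ can reach an accepting state, then $\mathcal A$ is determinizable if and only if $\mathcal A$ has no short separation; (c) in any case, if $\mathcal A$ has no short separation, then $\mathcal A$ is determinizable; (d) $\mathcal A$ is determinizable if and only if the NDA obtained from $\mathcal A$ by deleting all states from which no accepting state can be reached has no short separation (with $|Q|$, $m_{\mathcal A}$ and $\mathcal N$ those of the smaller automaton); (e) $\mathcal A$ is determinizable if and only if it is equivalent to a DDA that has the same discount factor as $\mathcal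 A$. -/

import Mathlib

/-- A nondeterministic integral discounted-sum automaton (NDA) over the alphabet `S` with state
set `Q` (both are assumed finite where this matters).  `trans p σ q = some c` says that
`(p, σ, q)` is a transition and has weight `c`; `none` says that it is not a transition.
`final q = some c` says that `q` is accepting with final weight `c`; `none` says that `q` is not
accepting.  Neither the transition relation nor the set of accepting states has to be total. -/
structure NDA (S : Type*) (Q : Type*) where
  /-- the set of initial states (possibly empty) -/
  init : Set Q
  /-- the transition relation together with its weights -/
  trans : Q → S → Q → Option ℕ
  /-- the accepting states together with their final weights -/
  final : Q → Option ℕ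
  /-- the discount factor -/
  lam : ℕ
  one_lt_lam : 1 < lam

namespace NDA

/-- The set of accepting states. -/
def acc {S Q : Type*} (A : NDA S Q) : Set Q := {q | (A.final q).isSome}

/-- `ρ = ρ₀, …, ρₙ` is a run on `w = w₁ ⋯ wₙ`, from an arbitrary state. -/
def IsRun {S Q : Type*} (A : NDA S Q) (w : List S) (ρ : Fin (w.length + 1) → Q) : Prop :=
  ∀ i : Fin w.length, (A.trans (ρ i.castSucc) (w.get i) (ρ i.succ)).isSome

/-- The discounted sum of the weights along a run (the default `0` is never used on a run). -/
noncomputable def runWeight {S Q : Type*} (A : NDA S Q) (w : List S)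
    (ρ : Fin (w.length + 1) → Q) : ℝ :=
  ∑ i : Fin w.length,
    ((A.trans (ρ i.castSucc) (w.get i) (ρ i.succ)).getD 0 : ℝ) / (A.lam : ℝ) ^ (i : ℕ)

/-- The weight of a minimal run on `w` from some state in `P` to some state in `P'`, without final
weights; it is `⊤` if there is no such run.  There are finitely many runs on `w` when `Q` is
finite, so that the infimum is then a minimum. -/
noncomputable def minWeight {S Q : Type*} (A : NDA S Q) (P P' : Set Q) (w : List S) : EReal :=
  ⨅ (ρ : Fin (w.length + 1) → Q)
    (_ : A.IsRun w ρ ∧ ρ 0 ∈ P ∧ ρ (Fin.last w.length) ∈ P'),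
    ((A.runWeight w ρ : ℝ) : EReal)

/-- The minimal weight, including the discounted final weight, of an accepting run on `w` from some
state in `P` to some state in `P'`; it is `⊤` if there is no such run. -/
noncomputable def minFinalWeight {S Q : Type*} (A : NDA S Q) (P P' : Set Q) (w : List S) : EReal :=
  ⨅ (ρ : Fin (w.length + 1) → Q)
    (_ : A.IsRun w ρ ∧ ρ 0 ∈ P ∧ ρ (Fin.last w.length) ∈ P' ∧ ρ (Fin.last w.length) ∈ A.acc),
    ((A.runWeight w ρ +
      ((A.final (ρ (Fin.last w.length))).getD 0 : ℝ) / (A.lam : ℝ) ^ w.length : ℝ) : EReal)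

/-- The value of the word `w`. -/
noncomputable def value {S Q : Type*} (A : NDA S Q) (w : List S) : EReal :=
  A.minFinalWeight A.init A.acc w

/-- Two automata over the same alphabet (with possibly different state sets and discount factors)
are equivalent if they give every word the same value. -/
def Equivalent {S Q Q' : Type*} (A : NDA S Q) (B : NDA S Q') : Prop :=
  ∀ w : List S, A.value w = B.value w

/-- There is exactly one initial state, and every state has at most one `σ`-successor for every
letter `σ`. -/
def IsDeterministic {S Q : Type*} (A : NDA S Q) : Prop :=
  (∃! q, q ∈ A.init) ∧ ∀ (p : Q) (σ : S), {q | (A.trans p σ q).isSome}.Subsingleton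

/-- `A` has an equivalent deterministic automaton whose discount factor is `μ`. -/
def DeterminizableWith {S Q : Type*} (A : NDA S Q) (μ : ℕ) : Prop :=
  ∃ (Q' : Type) (_ : Finite Q') (D : NDA S Q'), D.lam = μ ∧ D.IsDeterministic ∧ A.Equivalent D

/-- `A` has an equivalent deterministic automaton (with whatever integral discount factor). -/
def Determinizable {S Q : Type*} (A : NDA S Q) : Prop :=
  ∃ (Q' : Type) (_ : Finite Q') (D : NDA S Q'), D.IsDeterministic ∧ A.Equivalent D

/-- `(w, qu, ql)` is a recoverable gap with respect to `z`. -/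
def IsRecoverableGap {S Q : Type*} (A : NDA S Q) (w : List S) (qu ql : Q) (z : List S) : Prop :=
  A.minWeight A.init {ql} w ≤ A.minWeight A.init {qu} w ∧
  A.minWeight A.init {qu} w
      + ((((A.lam : ℝ) ^ w.length)⁻¹ : ℝ) : EReal) * A.minFinalWeight {qu} A.acc z
    = A.value (w ++ z) ∧
  A.value (w ++ z) < ⊤

/-- `w` has the `n`-separation property with respect to `(U, L, qu, z)`.  In the first inequality
`⊤ - x = ⊤` for real `x`, while `x - ⊤ = ⊤ - ⊤ = ⊥` is not larger than `n`. -/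
def HasSeparationWrt {S Q : Type*} (A : NDA S Q) (n : ℝ) (w : List S) (U L : Set Q) (qu : Q)
    (z : List S) : Prop :=
  U.Nonempty ∧ L.Nonempty ∧ Disjoint U L ∧ U ∪ L = Set.univ ∧
  (∀ u ∈ U, ∀ l ∈ L,
    (n : EReal) < (((A.lam : ℝ) ^ w.length : ℝ) : EReal)
      * (A.minWeight A.init {u} w - A.minWeight A.init {l} w)) ∧
  qu ∈ U ∧ ∀ l ∈ L, A.IsRecoverableGap w qu l z

/-- The maximal weight of a transition or a final weight (`0` if there are none). -/
noncomputable def maxWeight {S Q : Type*} (A : NDA S Q) : ℕ :=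
  sSup ({c | ∃ p σ q, A.trans p σ q = some c} ∪ {c | ∃ q, A.final q = some c})

/-- The constant `M = 2 (λ / (λ - 1)) m`. -/
noncomputable def constM {S Q : Type*} (A : NDA S Q) : ℝ :=
  2 * ((A.lam : ℝ) / ((A.lam : ℝ) - 1)) * (A.maxWeight : ℝ)

/-- The constant `N = λ ^ (|Q|² 2 ^ (|Q|²)) ((|Q| - 1) M + M) - M`; that is, the value at
`(|Q| - 1) M` of the `|Q|² 2 ^ (|Q|²)`-th iterate of `x ↦ λ (x + 2 m)`. -/
noncomputable def constN {S Q : Type*} (A : NDA S Q) : ℝ :=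
  (A.lam : ℝ) ^ (Nat.card Q ^ 2 * 2 ^ (Nat.card Q ^ 2))
    * (((Nat.card Q : ℝ) - 1) * A.constM + A.constM) - A.constM

/-- The bound `((λ / (λ - 1)) (N |Q| + 2 m) + 2) ^ |Q|` on the length of `w`. -/
noncomputable def wordBound {S Q : Type*} (A : NDA S Q) : ℝ :=
  ((A.lam : ℝ) / ((A.lam : ℝ) - 1) * (A.constN * (Nat.card Q : ℝ) + 2 * (A.maxWeight : ℝ)) + 2)
    ^ Nat.card Q

/-- The pairs `(w, z)` of words that have to be inspected. -/
def shortPairs {S Q : Type*} (A : NDA S Q) : Set (List S × List S) :=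
  {wz | (wz.1.length : ℝ) ≤ A.wordBound ∧ wz.2.length ≤ 2 ^ (2 * Nat.card Q)}

/-- Some short word `w` has the `N`-separation property with respect to some short suffix `z`. -/
def HasShortSeparation {S Q : Type*} (A : NDA S Q) : Prop :=
  ∃ wz ∈ A.shortPairs, ∃ (U L : Set Q) (qu : Q), A.HasSeparationWrt A.constN wz.1 U L qu wz.2

/-- Some run from an initial state ends in `q`. -/
def Reachable {S Q : Type*} (A : NDA S Q) (q : Q) : Prop :=
  ∃ w : List S, A.minWeight A.init {q} w < ⊤

/-- Some accepting run starts in `q`. -/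
def CoReachable {S Q : Type*} (A : NDA S Q) (q : Q) : Prop :=
  ∃ z : List S, A.minFinalWeight {q} A.acc z < ⊤

/-- `A` without the states from which no accepting run starts. -/
def trim {S Q : Type*} (A : NDA S Q) : NDA S {q : Q // A.CoReachable q} where
  init := {q | q.1 ∈ A.init}
  trans p σ q := A.trans p.1 σ q.1
  final q := A.final q.1
  lam := A.lam
  one_lt_lam := A.one_lt_lam

/-- Descriptions of automata by finite tables of natural numbers: the number of letters, the number
of states, the discount factor, and the tables of `init`, `final` and `trans`. -/
abbrev Code : Type :=
  ℕ × ℕ × ℕ × List Bool × List (Option ℕ) × List (List (List (Option ℕ)))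

open Classical in
/-- The description of an automaton with letters `0, …, k - 1` and states `0, …, n - 1`. -/
noncomputable def encode {k n : ℕ} (A : NDA (Fin k) (Fin n)) : Code :=
  (k, n, A.lam,
    List.ofFn fun q => decide (q ∈ A.init),
    List.ofFn fun q => A.final q,
    List.ofFn fun p => List.ofFn fun σ => List.ofFn fun q => A.trans p σ q)

end NDA

/-!
Costs are scaled by `λ ^ |w|`, so that they are natural numbers or `⊤`. The scaled costs of the
states after a word form a vector with a simple recursion (`step`, `icost`), the scaled costs of
accepting a suffix another one (`tail`), and the scaled value of `wz` is the minimum over the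
states `q` of `λ ^ |z| * icost w q + tail z q` (`iInf_icost_add_tail`). A run on `z` costs at most
`runBound * λ ^ |z|` in this scaling (`tail_le`, `wt_le`), where `runBound = m λ / (λ - 1)`.

*Small gaps suffice for determinization.* The subset construction with cost differences as states
is made finite by dropping each cost that exceeds the minimum by more than a bound `B`
(`cappedDet`). If the dropped costs are never needed, this deterministic automaton has the right
values. Otherwise a dropped cost is needed first at some word. What is lost there depends only on
the state of the capped automaton, so that the word can be taken no longer than the number of
these states; the suffix matters only through the set of states that accept it, so that it can be
taken shorter than the number of sets of states (`exists_short_gap`). The needed cost is more than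
`|Q| N` above the minimum, and so two consecutive costs, the upper one at most the needed cost, are
more than `N` apart (`exists_cut`): this is a short separation.

*Large gaps preclude determinization.* Let the state `q` be optimal for `wz`, with a cost more than
`N` above the cost of a state `l` that accepts some suffix. Tracing the costs back along the last
letters of `w`, at each of the last prefixes of `w` all states that accept the rest of `wz` lie more
than `runBound` above a state that leads to `l` (`gap_at_prefix`). There are so many of these
prefixes that two of the corresponding suffixes of `w` agree on the states that accept and on the
states that stay alive. The factor between them can be repeated without changing either set, and
the gap, taken before the repeated factor, persists: the values of two continuations of
arbitrarily long words differ by at least a positive constant. In a deterministic automaton, with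
whatever discount factor, the difference tends to zero (`not_determinizable_of_pumping`).

*Decidability.* The criterion is insensitive to enlarging the bounds
(`determinizable_iff_not_hasGapWithin`), and can be restated with the states from which acceptance
is possible so that no trimming is needed. The Gödel number of the table bounds the number of
states, the discount factor and all weights. The decision procedure lists all runs on all words up
to a length that is computed from this number.
-/

namespace NDA

/-! ### Scaled costs -/

/-- The cost of an optional weight: `none`, the absence of a transition, costs `⊤`. -/
noncomputable def optCost (o : Option ℕ) : ℕ∞ := o.elim ⊤ fun c => (c : ℕ∞)

@[simp] theorem optCost_none : optCost none = ⊤ := rfl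

@[simp] theorem optCost_some (c : ℕ) : optCost (some c) = c := rfl

theorem optCost_eq_coe {o : Option ℕ} {k : ℕ} : optCost o = k ↔ o = some k := by
  cases o with
  | none => simp
  | some c => simp

theorem optCost_ne_top {o : Option ℕ} : optCost o ≠ ⊤ ↔ o.isSome := by
  cases o <;> simp

variable {S Q : Type*} (A : NDA S Q)

/-- One step of the scaled cost vectors: if `d p` is the cost of `p` after `w`, scaled by
`λ ^ |w|`, then `step d σ q` is the minimal cost of `q` after `wσ`, scaled by `λ ^ (|w| + 1)`. -/
noncomputable def step (d : Q → ℕ∞) (σ : S) (q : Q) : ℕ∞ :=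
  ⨅ p, (A.lam : ℕ∞) * (d p + optCost (A.trans p σ q))

/-- The scaled costs of the states after `w`, if `d` holds the costs before `w`. -/
noncomputable def cost (d : Q → ℕ∞) (w : List S) : Q → ℕ∞ := w.foldl A.step d

open Classical in
/-- The cost vector that is `0` on `P` and `⊤` elsewhere. -/
noncomputable def ind (P : Set Q) (q : Q) : ℕ∞ := if q ∈ P then 0 else ⊤

/-- The minimal cost of an accepting run on `z` from `q`, scaled by `λ ^ |z|`. -/
noncomputable def tail : List S → Q → ℕ∞
  | [], q => optCost (A.final q)
  | σ :: z, q => ⨅ p, (A.lam : ℕ∞) ^ (z.length + 1) * optCost (A.trans q σ p) + tail z p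

/-- The value of `w`, scaled by `λ ^ |w|`. -/
noncomputable def val (w : List S) : ℕ∞ := ⨅ q, ind A.init q + A.tail w q

/-- The minimal weight of a run on `w` from `p` to `q`, scaled by `λ ^ |w|`. -/
noncomputable def wt (w : List S) (p q : Q) : ℕ∞ := A.cost (ind {p}) w q

/-- The scaled costs of the states after `w`, starting from the initial states. -/
noncomputable def icost (w : List S) : Q → ℕ∞ := A.cost (ind A.init) w

theorem lam_ne_zero : (A.lam : ℕ∞) ≠ 0 := by
  have := A.one_lt_lam
  exact_mod_cast (by omega : A.lam ≠ 0)

theorem lam_pow_ne_zero (n : ℕ) : (A.lam : ℕ∞) ^ n ≠ 0 := pow_ne_zero _ A.lam_ne_zero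

@[simp] theorem ind_of_mem {P : Set Q} {q : Q} (h : q ∈ P) : ind P q = 0 := if_pos h

@[simp] theorem ind_of_notMem {P : Set Q} {q : Q} (h : q ∉ P) : ind P q = ⊤ := if_neg h

theorem ind_ne_top {P : Set Q} {q : Q} : ind P q ≠ ⊤ ↔ q ∈ P := by
  by_cases h : q ∈ P <;> simp [h]

@[simp] theorem cost_nil (d : Q → ℕ∞) : A.cost d [] = d := rfl

@[simp] theorem cost_cons (d : Q → ℕ∞) (σ : S) (w : List S) :
    A.cost d (σ :: w) = A.cost (A.step d σ) w := rfl

theorem cost_append (d : Q → ℕ∞) (w v : List S) :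
    A.cost d (w ++ v) = A.cost (A.cost d w) v := List.foldl_append

theorem cost_concat (d : Q → ℕ∞) (w : List S) (σ : S) :
    A.cost d (w ++ [σ]) = A.step (A.cost d w) σ := by simp [cost_append]

theorem icost_append (w v : List S) : A.icost (w ++ v) = A.cost (A.icost w) v :=
  A.cost_append _ _ _

theorem step_mono {d d' : Q → ℕ∞} (h : d ≤ d') (σ : S) : A.step d σ ≤ A.step d' σ := by
  intro q
  exact iInf_mono fun p => by gcongr; exact h p

theorem step_add (C : ℕ∞) (d : Q → ℕ∞) (σ : S) (q : Q) :
    A.step (fun p => C + d p) σ q = A.lam * C + A.step d σ q := by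
  simp only [step, ENat.add_iInf, add_assoc, mul_add]

theorem iInf_ind_add (P : Set Q) (f : Q → ℕ∞) : ⨅ q, ind P q + f q = ⨅ q ∈ P, f q := by
  refine iInf_congr fun q => ?_
  by_cases h : q ∈ P <;> simp [h]

theorem iInf_ind_singleton_add (p : Q) (f : Q → ℕ∞) : ⨅ q, ind {p} q + f q = f p := by
  rw [iInf_ind_add]
  exact iInf_iInf_eq_left

theorem mul_ind (P : Set Q) (q : Q) {c : ℕ∞} (hc : c ≠ 0) : c * ind P q = ind P q := by
  by_cases h : q ∈ P <;> simp [h, ENat.mul_top, hc]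

/-- Splitting off the first letter of the suffix. -/
theorem iInf_step_add_tail (d : Q → ℕ∞) (σ : S) (z : List S) :
    ⨅ q, (A.lam : ℕ∞) ^ z.length * A.step d σ q + A.tail z q =
      ⨅ p, (A.lam : ℕ∞) ^ (z.length + 1) * d p + A.tail (σ :: z) p := by
  simp only [step, tail, ENat.mul_iInf_of_ne (A.lam_pow_ne_zero _), ENat.iInf_add, ENat.add_iInf]
  rw [iInf_comm]
  refine iInf_congr fun p => iInf_congr fun q => ?_
  ring

/-- Prefix costs and suffix costs combine to the same optimum at every position. -/
theorem iInf_cost_add_tail (d : Q → ℕ∞) (w z : List S) :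
    ⨅ q, (A.lam : ℕ∞) ^ z.length * A.cost d w q + A.tail z q =
      ⨅ p, (A.lam : ℕ∞) ^ (w.length + z.length) * d p + A.tail (w ++ z) p := by
  induction w generalizing d with
  | nil => simp
  | cons σ w ih =>
    rw [cost_cons, ih, ← List.length_append, iInf_step_add_tail]
    simp [List.length_append, add_right_comm]

theorem iInf_icost_add_tail (w z : List S) :
    ⨅ q, (A.lam : ℕ∞) ^ z.length * A.icost w q + A.tail z q = A.val (w ++ z) := by
  rw [icost, iInf_cost_add_tail, val]
  simp only [mul_ind _ _ (A.lam_pow_ne_zero _)]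

theorem tail_append (w z : List S) (p : Q) :
    A.tail (w ++ z) p = ⨅ q, (A.lam : ℕ∞) ^ z.length * A.wt w p q + A.tail z q := by
  simp only [wt]
  rw [iInf_cost_add_tail]
  simp only [mul_ind _ _ (A.lam_pow_ne_zero _), iInf_ind_singleton_add]

theorem val_le (w z : List S) (q : Q) :
    A.val (w ++ z) ≤ (A.lam : ℕ∞) ^ z.length * A.icost w q + A.tail z q := by
  rw [← iInf_icost_add_tail]
  exact iInf_le _ q

/-- A cost vector is a minimum over the states before `w`. -/
theorem cost_eq_iInf (d : Q → ℕ∞) (w : List S) (q : Q) :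
    A.cost d w q = ⨅ p, (A.lam : ℕ∞) ^ w.length * d p + A.wt w p q := by
  induction w using List.reverseRecOn generalizing q with
  | nil =>
    simp only [cost_nil, List.length_nil, pow_zero, one_mul, wt]
    have : ∀ p, d p + ind {p} q = ind {q} p + d p := by
      intro p
      rw [add_comm]
      congr 1
      by_cases h : p = q
      · subst h; rfl
      · simp [h, Ne.symm h]
    simp only [this, iInf_ind_singleton_add]
  | append_singleton w σ ih =>
    simp only [wt, cost_concat] at ih ⊢
    simp only [step, ih, ENat.iInf_add, ENat.mul_iInf_of_ne A.lam_ne_zero, ENat.add_iInf]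
    rw [iInf_comm]
    refine iInf_congr fun p => iInf_congr fun r => ?_
    simp only [List.length_append, List.length_singleton]
    ring

theorem wt_cons (σ : S) (w : List S) (p q : Q) :
    A.wt (σ :: w) p q =
      ⨅ r, (A.lam : ℕ∞) ^ (w.length + 1) * optCost (A.trans p σ r) + A.wt w r q := by
  rw [wt, cost_cons, cost_eq_iInf]
  refine iInf_congr fun r => ?_
  congr 1
  simp only [step, ← ENat.mul_iInf_of_ne A.lam_ne_zero, iInf_ind_singleton_add]
  ring

theorem wt_nil (p q : Q) : A.wt [] p q = ind {p} q := rfl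

theorem exists_eq_of_iInf_ne_top {ι : Type*} {f : ι → ℕ∞} (h : ⨅ i, f i ≠ ⊤) :
    ∃ i, f i = ⨅ i, f i := by
  have : Nonempty ι := by
    by_contra hι
    rw [not_nonempty_iff] at hι
    exact h (iInf_of_empty _)
  exact ENat.exists_eq_iInf f

theorem iInf_ne_top_iff {ι : Type*} {f : ι → ℕ∞} : ⨅ i, f i ≠ ⊤ ↔ ∃ i, f i ≠ ⊤ := by
  simp [iInf_eq_top]

theorem mul_pow_add_ne_top {n : ℕ} {a b : ℕ∞} :
    (A.lam : ℕ∞) ^ n * a + b ≠ ⊤ ↔ a ≠ ⊤ ∧ b ≠ ⊤ := by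
  rw [Ne, ENat.add_eq_top, not_or]
  refine and_congr_left fun _ => not_congr ⟨fun h => ?_, fun h => ?_⟩
  · by_contra ha
    obtain ⟨k, rfl⟩ : ∃ k : ℕ, a = k := ⟨a.toNat, (ENat.natCast_toNat ha).symm⟩
    exact ENat.natCast_ne_top (A.lam ^ n * k) (by exact_mod_cast h)
  · rw [h, ENat.mul_top (A.lam_pow_ne_zero n)]

/-- The states that accept `z`. -/
def accepting (z : List S) : Set Q := {q | A.tail z q ≠ ⊤}

theorem mem_accepting_append {w z : List S} {p : Q} :
    p ∈ A.accepting (w ++ z) ↔ ∃ q, A.wt w p q ≠ ⊤ ∧ q ∈ A.accepting z := by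
  simp only [accepting, Set.mem_ofPred_eq, tail_append, iInf_ne_top_iff, mul_pow_add_ne_top]

theorem accepting_append_congr {z z' : List S} (h : A.accepting z = A.accepting z')
    (w : List S) : A.accepting (w ++ z) = A.accepting (w ++ z') := by
  ext p
  simp only [mem_accepting_append, h]

end NDA

namespace NDA

variable {S Q : Type*} (A : NDA S Q)

/-! ### Bounds on suffix costs -/

theorem bddAbove_weights [Finite S] [Finite Q] : BddAbove
    ({c | ∃ p σ q, A.trans p σ q = some c} ∪ {c | ∃ q, A.final q = some c}) := by
  refine Set.Finite.bddAbove (Set.Finite.union ?_ ?_)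
  · refine (Set.finite_range fun x : Q × S × Q => (A.trans x.1 x.2.1 x.2.2).getD 0).subset ?_
    rintro c ⟨p, σ, q, h⟩
    exact ⟨(p, σ, q), by simp [h]⟩
  · refine (Set.finite_range fun q : Q => (A.final q).getD 0).subset ?_
    rintro c ⟨q, h⟩
    exact ⟨q, by simp [h]⟩

theorem trans_le_maxWeight [Finite S] [Finite Q] {p : Q} {σ : S} {q : Q} {c : ℕ}
    (h : A.trans p σ q = some c) : c ≤ A.maxWeight :=
  le_csSup A.bddAbove_weights (Or.inl ⟨p, σ, q, h⟩)

theorem final_le_maxWeight [Finite S] [Finite Q] {q : Q} {c : ℕ}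
    (h : A.final q = some c) : c ≤ A.maxWeight :=
  le_csSup A.bddAbove_weights (Or.inr ⟨q, h⟩)

/-- The bound `m λ / (λ - 1)` on the weight of an accepting run, including the final weight. -/
noncomputable def runBound : ℝ := (A.lam : ℝ) / ((A.lam : ℝ) - 1) * A.maxWeight

theorem one_lt_lam_real : (1 : ℝ) < A.lam := by exact_mod_cast A.one_lt_lam

theorem two_le_lam_real : (2 : ℝ) ≤ A.lam := by exact_mod_cast A.one_lt_lam

theorem lam_pos_real : (0 : ℝ) < A.lam := zero_lt_one.trans A.one_lt_lam_real

theorem runBound_nonneg : 0 ≤ A.runBound := by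
  have := A.one_lt_lam_real
  exact mul_nonneg (div_nonneg (by linarith) (by linarith)) (Nat.cast_nonneg _)

theorem constM_eq : A.constM = 2 * A.runBound := by
  rw [constM, runBound, mul_assoc]

/-- The recursion that makes `runBound` an inductive bound on the weight of a run. -/
theorem lam_mul_runBound : A.lam * A.runBound = A.lam * A.maxWeight + A.runBound := by
  have : (A.lam : ℝ) - 1 ≠ 0 := by linarith [A.one_lt_lam_real]
  rw [runBound]
  field_simp
  ring

theorem maxWeight_le_runBound : (A.maxWeight : ℝ) ≤ A.runBound := by
  have h := A.lam_mul_runBound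
  have h1 := A.one_lt_lam_real
  have h2 := A.runBound_nonneg
  nlinarith

theorem runBound_le : A.runBound ≤ 2 * A.maxWeight := by
  have h := A.lam_mul_runBound
  have h1 := A.two_le_lam_real
  have h2 : (0 : ℝ) ≤ A.maxWeight := Nat.cast_nonneg _
  by_contra! h3
  nlinarith

theorem lift_nat {x : ℕ∞} (h : x ≠ ⊤) : ∃ k : ℕ, x = k := ⟨x.toNat, (ENat.natCast_toNat h).symm⟩

theorem mul_pow_add_eq_coe {n : ℕ} {a b : ℕ∞} {k : ℕ} :
    (A.lam : ℕ∞) ^ n * a + b = k ↔ ∃ a' b' : ℕ, a = a' ∧ b = b' ∧ A.lam ^ n * a' + b' = k := by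
  constructor
  · intro h
    obtain ⟨ha, hb⟩ := A.mul_pow_add_ne_top.1 (h.trans_ne (ENat.natCast_ne_top k))
    obtain ⟨a', rfl⟩ := lift_nat ha
    obtain ⟨b', rfl⟩ := lift_nat hb
    exact ⟨a', b', rfl, rfl, by exact_mod_cast h⟩
  · rintro ⟨a', b', rfl, rfl, rfl⟩
    push_cast
    rfl

theorem eq_of_mul_pow_add_eq {n : ℕ} {a a' b : ℕ∞}
    (h : (A.lam : ℕ∞) ^ n * a + b = (A.lam : ℕ∞) ^ n * a' + b)
    (hne : (A.lam : ℕ∞) ^ n * a' + b ≠ ⊤) : a = a' := by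
  obtain ⟨ha', hb⟩ := A.mul_pow_add_ne_top.1 hne
  obtain ⟨ha, -⟩ := A.mul_pow_add_ne_top.1 (h.trans_ne hne)
  obtain ⟨a', rfl⟩ := lift_nat ha'
  obtain ⟨a, rfl⟩ := lift_nat ha
  obtain ⟨b, rfl⟩ := lift_nat hb
  have h1 : A.lam ^ n * a + b = A.lam ^ n * a' + b := by exact_mod_cast h
  have hpos : 0 < A.lam ^ n := pow_pos (by have := A.one_lt_lam; omega) _
  rw [Nat.eq_of_mul_eq_mul_left hpos (Nat.add_right_cancel h1)]

theorem tail_le [Finite S] [Finite Q] {z : List S} {q : Q} {k : ℕ} (h : A.tail z q = k) :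
    (k : ℝ) ≤ A.runBound * A.lam ^ z.length := by
  induction z generalizing q k with
  | nil =>
    have := A.final_le_maxWeight (optCost_eq_coe.1 h)
    have h' : (k : ℝ) ≤ A.maxWeight := by exact_mod_cast this
    simpa using h'.trans A.maxWeight_le_runBound
  | cons σ z ih =>
    rw [tail] at h
    obtain ⟨p, hp⟩ := exists_eq_of_iInf_ne_top (h.trans_ne (ENat.natCast_ne_top k))
    rw [h, A.mul_pow_add_eq_coe] at hp
    obtain ⟨a, b, ha, hb, rfl⟩ := hp
    have h1 := ih hb
    have h2 : (a : ℝ) ≤ A.maxWeight := by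
      exact_mod_cast A.trans_le_maxWeight (optCost_eq_coe.1 ha)
    have h3 := A.lam_mul_runBound
    have h4 : (0 : ℝ) ≤ A.lam ^ z.length := pow_nonneg A.lam_pos_real.le _
    have h5 := mul_le_mul_of_nonneg_left h2 (mul_nonneg h4 A.lam_pos_real.le)
    push_cast
    rw [List.length_cons, pow_succ]
    calc (A.lam : ℝ) ^ z.length * A.lam * a + b
        ≤ A.lam ^ z.length * (A.lam * A.maxWeight + A.runBound) := by linarith
      _ = A.runBound * (A.lam ^ z.length * A.lam) := by rw [← h3]; ring

theorem wt_le [Finite S] [Finite Q] {w : List S} {p q : Q} {k : ℕ} (h : A.wt w p q = k) :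
    (k : ℝ) ≤ A.runBound * (A.lam ^ w.length - 1) := by
  induction w generalizing p k with
  | nil =>
    by_cases hq : q ∈ ({p} : Set Q)
    · rw [wt_nil, ind_of_mem hq] at h
      have : k = 0 := by exact_mod_cast h.symm
      simp [this]
    · rw [wt_nil, ind_of_notMem hq] at h
      exact absurd h.symm (ENat.natCast_ne_top k)
  | cons σ w ih =>
    rw [wt_cons] at h
    obtain ⟨r, hr⟩ := exists_eq_of_iInf_ne_top (h.trans_ne (ENat.natCast_ne_top k))
    rw [h, A.mul_pow_add_eq_coe] at hr
    obtain ⟨a, b, ha, hb, rfl⟩ := hr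
    have h1 := ih hb
    have h2 : (a : ℝ) ≤ A.maxWeight := by
      exact_mod_cast A.trans_le_maxWeight (optCost_eq_coe.1 ha)
    have h3 := A.lam_mul_runBound
    have h4 : (0 : ℝ) ≤ A.lam ^ w.length := pow_nonneg A.lam_pos_real.le _
    have h5 := mul_le_mul_of_nonneg_left h2 (mul_nonneg h4 A.lam_pos_real.le)
    push_cast
    rw [List.length_cons, pow_succ]
    calc (A.lam : ℝ) ^ w.length * A.lam * a + b
        ≤ A.lam ^ w.length * (A.lam * A.maxWeight + A.runBound) - A.runBound := by linarith
      _ = A.runBound * (A.lam ^ w.length * A.lam - 1) := by rw [← h3]; ring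

/-! ### Minimal weights of runs -/

/-- Some run on `w` from `p` to `q` has weight `k`, scaled by `λ ^ |w|`. -/
def Path : List S → Q → Q → ℕ → Prop
  | [], p, q, k => p = q ∧ k = 0
  | σ :: w, p, q, k => ∃ r c k', A.trans p σ r = some c ∧ Path w r q k' ∧
      k = A.lam ^ (w.length + 1) * c + k'

theorem wt_le_of_path {w : List S} {p q : Q} {k : ℕ} (h : A.Path w p q k) : A.wt w p q ≤ k := by
  induction w generalizing p k with
  | nil =>
    obtain ⟨rfl, rfl⟩ := h
    simp [wt_nil]
  | cons σ w ih =>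
    obtain ⟨r, c, k', h1, h2, rfl⟩ := h
    rw [wt_cons]
    refine (iInf_le _ r).trans ?_
    rw [h1]
    push_cast
    exact add_le_add le_rfl (ih h2)

theorem path_of_wt_eq {w : List S} {p q : Q} {k : ℕ} (h : A.wt w p q = k) : A.Path w p q k := by
  induction w generalizing p k with
  | nil =>
    by_cases hq : q ∈ ({p} : Set Q)
    · rw [wt_nil, ind_of_mem hq] at h
      exact ⟨hq.symm, by exact_mod_cast h.symm⟩
    · rw [wt_nil, ind_of_notMem hq] at h
      exact absurd h.symm (ENat.natCast_ne_top k)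
  | cons σ w ih =>
    rw [wt_cons] at h
    obtain ⟨r, hr⟩ := exists_eq_of_iInf_ne_top (h.trans_ne (ENat.natCast_ne_top k))
    rw [h, A.mul_pow_add_eq_coe] at hr
    obtain ⟨a, b, ha, hb, rfl⟩ := hr
    exact ⟨r, a, b, optCost_eq_coe.1 ha, ih hb, rfl⟩

theorem isRun_cons {σ : S} {w : List S} {ρ : Fin (w.length + 1 + 1) → Q} :
    A.IsRun (σ :: w) ρ ↔ (A.trans (ρ 0) σ (ρ 1)).isSome ∧ A.IsRun w (fun i => ρ i.succ) := by
  constructor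
  · intro h
    exact ⟨h 0, fun i => h i.succ⟩
  · rintro ⟨h1, h2⟩ i
    exact Fin.cases h1 h2 i

theorem runWeight_cons {σ : S} {w : List S} {ρ : Fin (w.length + 1 + 1) → Q} :
    A.runWeight (σ :: w) ρ = ((A.trans (ρ 0) σ (ρ 1)).getD 0 : ℝ)
      + A.runWeight w (fun i => ρ i.succ) / A.lam := by
  have h0 := A.lam_pos_real.ne'
  simp only [runWeight]
  rw [Finset.sum_div]
  refine (Fin.sum_univ_succ (n := w.length) _).trans ?_
  congr 1
  · simp
  · refine Finset.sum_congr rfl fun i _ => ?_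
    rw [div_div, ← pow_succ]
    rfl

theorem path_of_isRun {w : List S} {ρ : Fin (w.length + 1) → Q} (h : A.IsRun w ρ) :
    ∃ k : ℕ, A.Path w (ρ 0) (ρ (Fin.last w.length)) k ∧
      A.runWeight w ρ = (k : ℝ) / A.lam ^ w.length := by
  induction w with
  | nil => exact ⟨0, ⟨rfl, rfl⟩, by simp [runWeight]⟩
  | cons σ w ih =>
    obtain ⟨h1, h2⟩ := A.isRun_cons.1 h
    obtain ⟨k, hk, hw⟩ := ih h2
    obtain ⟨c, hc⟩ := Option.isSome_iff_exists.1 h1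
    refine ⟨_, ⟨ρ 1, c, k, hc, hk, rfl⟩, ?_⟩
    have h0 := A.lam_pos_real.ne'
    rw [runWeight_cons, hw, hc]
    simp only [Option.getD_some, List.length_cons]
    push_cast
    field_simp
    ring

theorem exists_isRun_of_path {w : List S} {p q : Q} {k : ℕ} (h : A.Path w p q k) :
    ∃ ρ : Fin (w.length + 1) → Q, A.IsRun w ρ ∧ ρ 0 = p ∧ ρ (Fin.last w.length) = q ∧
      A.runWeight w ρ = (k : ℝ) / A.lam ^ w.length := by
  induction w generalizing p k with
  | nil =>
    obtain ⟨rfl, rfl⟩ := h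
    exact ⟨fun _ => p, fun i => i.elim0, rfl, rfl, by simp [runWeight]⟩
  | cons σ w ih =>
    obtain ⟨r, c, k', h1, h2, rfl⟩ := h
    obtain ⟨ρ, hρ, hr, hq, hw⟩ := ih h2
    refine ⟨Fin.cons p ρ, A.isRun_cons.2 ⟨?_, hρ⟩, rfl, ?_, ?_⟩
    · change (A.trans p σ (ρ 0)).isSome
      rw [hr, h1]
      rfl
    · exact hq
    · have h0 := A.lam_pos_real.ne'
      rw [runWeight_cons]
      change ((A.trans p σ (ρ 0)).getD 0 : ℝ) + A.runWeight w ρ / A.lam = _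
      rw [hr, h1, hw]
      simp only [Option.getD_some, List.length_cons]
      push_cast
      field_simp
      ring

/-- The extended real number `x / λ ^ n`. -/
noncomputable def unscale (n : ℕ) : ℕ∞ → EReal
  | ⊤ => ⊤
  | (k : ℕ) => (((k : ℝ) / (A.lam : ℝ) ^ n : ℝ) : EReal)

@[simp] theorem unscale_top (n : ℕ) : A.unscale n ⊤ = ⊤ := rfl

theorem unscale_coe (n k : ℕ) : A.unscale n k = (((k : ℝ) / (A.lam : ℝ) ^ n : ℝ) : EReal) := rfl

theorem unscale_le_iff {n : ℕ} {x y : ℕ∞} : A.unscale n x ≤ A.unscale n y ↔ x ≤ y := by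
  have h0 : (0 : ℝ) < A.lam ^ n := pow_pos A.lam_pos_real n
  induction x using ENat.recTopCoe with
  | top =>
    induction y using ENat.recTopCoe with
    | top => simp
    | coe y => simp [unscale_coe]
  | coe x =>
    induction y using ENat.recTopCoe with
    | top => simp
    | coe y =>
      rw [unscale_coe, unscale_coe, EReal.coe_le_coe_iff, div_le_div_iff_of_pos_right h0]
      norm_cast

theorem unscale_inj {n : ℕ} {x y : ℕ∞} : A.unscale n x = A.unscale n y ↔ x = y := by
  simp only [le_antisymm_iff, unscale_le_iff]

theorem unscale_lt_top {n : ℕ} {x : ℕ∞} : A.unscale n x < ⊤ ↔ x ≠ ⊤ := by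
  rw [lt_top_iff_ne_top, ← A.unscale_top n, Ne, unscale_inj]

/-- An infimum of real numbers `k / λ ^ n` is attained, so that it is the unscaled minimum. -/
theorem iInf_eq_unscale {ι : Sort*} {p : ι → Prop} {f : ι → ℝ} {n : ℕ} {x : ℕ∞}
    (h1 : ∀ i, p i → ∃ k : ℕ, f i = (k : ℝ) / (A.lam : ℝ) ^ n ∧ x ≤ k)
    (h2 : ∀ k : ℕ, x = k → ∃ i, p i ∧ f i = (k : ℝ) / (A.lam : ℝ) ^ n) :
    ⨅ (i : ι) (_ : p i), ((f i : ℝ) : EReal) = A.unscale n x := by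
  apply le_antisymm
  · induction x using ENat.recTopCoe with
    | top => simp
    | coe k =>
      obtain ⟨i, hi, hk⟩ := h2 k rfl
      refine (iInf₂_le i hi).trans ?_
      rw [hk, unscale_coe]
  · refine le_iInf₂ fun i hi => ?_
    obtain ⟨k, hk, hx⟩ := h1 i hi
    rw [hk, ← unscale_coe, unscale_le_iff]
    exact hx

/-- Minimal weights of runs are the scaled costs, divided by `λ ^ |w|`. -/
theorem minWeight_eq (P : Set Q) (w : List S) (q : Q) :
    A.minWeight P {q} w = A.unscale w.length (A.cost (ind P) w q) := by
  have hc : A.cost (ind P) w q = ⨅ p ∈ P, A.wt w p q := by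
    rw [cost_eq_iInf, ← iInf_ind_add]
    simp only [mul_ind _ _ (A.lam_pow_ne_zero _)]
  refine A.iInf_eq_unscale ?_ ?_
  · rintro ρ ⟨h1, h2, h3⟩
    obtain ⟨k, hk, hw⟩ := A.path_of_isRun h1
    refine ⟨k, hw, ?_⟩
    rw [hc, ← (h3 : ρ (Fin.last w.length) = q)]
    exact (iInf₂_le (ρ 0) h2).trans (A.wt_le_of_path hk)
  · intro k hk
    rw [hc, ← iInf_ind_add] at hk
    obtain ⟨p, hp⟩ := exists_eq_of_iInf_ne_top (hk.trans_ne (ENat.natCast_ne_top k))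
    rw [hk] at hp
    have hP : p ∈ P := by
      by_contra hP
      simp [hP] at hp
    rw [ind_of_mem hP, zero_add] at hp
    obtain ⟨ρ, h1, h2, h3, h4⟩ := A.exists_isRun_of_path (A.path_of_wt_eq hp)
    exact ⟨ρ, ⟨h1, h2 ▸ hP, h3⟩, h4⟩

theorem tail_eq_iInf (w : List S) (p : Q) :
    A.tail w p = ⨅ q, A.wt w p q + optCost (A.final q) := by
  have := A.tail_append w [] p
  simpa [tail] using this

theorem minFinalWeight_eq (P : Set Q) (w : List S) :
    A.minFinalWeight P A.acc w = A.unscale w.length (⨅ p, ind P p + A.tail w p) := by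
  have hc : ⨅ p, ind P p + A.tail w p = ⨅ p ∈ P, ⨅ q, A.wt w p q + optCost (A.final q) := by
    simp only [iInf_ind_add, tail_eq_iInf]
  have h0 : (A.lam : ℝ) ^ w.length ≠ 0 := (pow_pos A.lam_pos_real _).ne'
  refine A.iInf_eq_unscale ?_ ?_
  · rintro ρ ⟨h1, h2, h3, h4⟩
    obtain ⟨k, hk, hw⟩ := A.path_of_isRun h1
    obtain ⟨c, hcc⟩ := Option.isSome_iff_exists.1 h4
    refine ⟨k + c, ?_, ?_⟩
    · rw [hw, hcc]
      push_cast
      simp [add_div]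
    · rw [hc]
      refine (iInf₂_le (ρ 0) h2).trans ((iInf_le _ (ρ (Fin.last w.length))).trans ?_)
      rw [hcc, optCost_some]
      push_cast
      exact add_le_add (A.wt_le_of_path hk) le_rfl
  · intro k hk
    rw [hc, ← iInf_ind_add] at hk
    obtain ⟨p, hp⟩ := exists_eq_of_iInf_ne_top (hk.trans_ne (ENat.natCast_ne_top k))
    rw [hk] at hp
    have hP : p ∈ P := by
      by_contra hP
      simp [hP] at hp
    rw [ind_of_mem hP, zero_add] at hp
    obtain ⟨q, hq⟩ := exists_eq_of_iInf_ne_top (hp.trans_ne (ENat.natCast_ne_top k))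
    rw [hp] at hq
    obtain ⟨ha, hb⟩ := not_or.1 (ENat.add_eq_top.not.1 (hq.trans_ne (ENat.natCast_ne_top k)))
    obtain ⟨a, ha⟩ := lift_nat ha
    obtain ⟨b, hb⟩ := lift_nat hb
    rw [ha, hb] at hq
    have hab : a + b = k := by exact_mod_cast hq
    have hfin := optCost_eq_coe.1 hb
    obtain ⟨ρ, h1, h2, h3, h4⟩ := A.exists_isRun_of_path (A.path_of_wt_eq ha)
    have hacc : q ∈ A.acc := by simp [acc, hfin]
    refine ⟨ρ, ⟨h1, h2 ▸ hP, h3 ▸ hacc, h3 ▸ hacc⟩, ?_⟩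
    rw [h4, h3, hfin, ← hab]
    push_cast
    simp [add_div]

theorem minFinalWeight_singleton (q : Q) (w : List S) :
    A.minFinalWeight {q} A.acc w = A.unscale w.length (A.tail w q) := by
  rw [minFinalWeight_eq, iInf_ind_singleton_add]

theorem value_eq (w : List S) : A.value w = A.unscale w.length (A.val w) :=
  A.minFinalWeight_eq _ _

theorem reachable_iff {q : Q} : A.Reachable q ↔ ∃ w, A.icost w q ≠ ⊤ := by
  simp only [Reachable, minWeight_eq, unscale_lt_top]
  rfl

theorem coReachable_iff {q : Q} : A.CoReachable q ↔ ∃ z, q ∈ A.accepting z := by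
  simp only [CoReachable, minFinalWeight_singleton, unscale_lt_top]
  rfl

theorem isRecoverableGap_iff {w : List S} {qu ql : Q} {z : List S} :
    A.IsRecoverableGap w qu ql z ↔ A.icost w ql ≤ A.icost w qu ∧
      (A.lam : ℕ∞) ^ z.length * A.icost w qu + A.tail z qu = A.val (w ++ z) ∧
      A.val (w ++ z) ≠ ⊤ := by
  have h0 : (A.lam : ℝ) ^ w.length ≠ 0 := (pow_pos A.lam_pos_real _).ne'
  have h0' : (0 : ℝ) < ((A.lam : ℝ) ^ w.length)⁻¹ := inv_pos.2 (pow_pos A.lam_pos_real _)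
  have h1 : (A.lam : ℝ) ^ z.length ≠ 0 := (pow_pos A.lam_pos_real _).ne'
  have key : A.minWeight A.init {qu} w
      + ((((A.lam : ℝ) ^ w.length)⁻¹ : ℝ) : EReal) * A.minFinalWeight {qu} A.acc z =
      A.unscale (w ++ z).length
        ((A.lam : ℕ∞) ^ z.length * A.icost w qu + A.tail z qu) := by
    rw [minWeight_eq, minFinalWeight_singleton, ← icost]
    generalize A.icost w qu = a
    generalize A.tail z qu = b
    induction b using ENat.recTopCoe with
    | top =>
      rw [unscale_top, EReal.coe_mul_top_of_pos h0', add_top, unscale_top]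
      induction a using ENat.recTopCoe with
      | top => simp
      | coe a => simp [unscale_coe]
    | coe b =>
      induction a using ENat.recTopCoe with
      | top =>
        rw [ENat.mul_top (A.lam_pow_ne_zero _), top_add, unscale_top, unscale_top, unscale_coe,
          ← EReal.coe_mul, EReal.top_add_coe]
      | coe a =>
        have : (A.lam : ℕ∞) ^ z.length * a + b = ((A.lam ^ z.length * a + b : ℕ) : ℕ∞) := by
          push_cast
          rfl
        rw [this, unscale_coe, unscale_coe, unscale_coe, ← EReal.coe_mul, ← EReal.coe_add]
        congr 1
        rw [List.length_append, pow_add]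
        push_cast
        field_simp
  rw [IsRecoverableGap, key, minWeight_eq, minWeight_eq, unscale_le_iff, value_eq, unscale_inj,
    unscale_lt_top]
  rfl

/-- The separation inequality in terms of scaled costs. -/
theorem lt_mul_sub_iff {n : ℝ} {w : List S} {u l : Q} :
    (n : EReal) < (((A.lam : ℝ) ^ w.length : ℝ) : EReal)
      * (A.minWeight A.init {u} w - A.minWeight A.init {l} w) ↔
    ∃ b : ℕ, A.icost w l = b ∧ ∀ a : ℕ, A.icost w u = a → n + b < a := by
  have h0 : (0 : ℝ) < (A.lam : ℝ) ^ w.length := pow_pos A.lam_pos_real _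
  rw [minWeight_eq, minWeight_eq, ← icost]
  generalize A.icost w u = a
  generalize A.icost w l = b
  induction b using ENat.recTopCoe with
  | top =>
    have : ¬ ∃ b : ℕ, (⊤ : ℕ∞) = b ∧ ∀ a' : ℕ, a = a' → n + b < a' := by
      rintro ⟨b, hb, -⟩
      exact ENat.natCast_ne_top b hb.symm
    rw [unscale_top, EReal.sub_top, EReal.coe_mul_bot_of_pos h0]
    exact iff_of_false not_lt_bot this
  | coe b =>
    induction a using ENat.recTopCoe with
    | top =>
      rw [unscale_top, unscale_coe, EReal.top_sub_coe, EReal.coe_mul_top_of_pos h0]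
      refine iff_of_true (EReal.coe_lt_top n) ⟨b, rfl, fun a ha => ?_⟩
      exact absurd ha.symm (ENat.natCast_ne_top a)
    | coe a =>
      rw [unscale_coe, unscale_coe, ← EReal.coe_sub, ← EReal.coe_mul, EReal.coe_lt_coe_iff,
        ← sub_div, mul_div_cancel₀ _ h0.ne', lt_sub_iff_add_lt]
      constructor
      · intro h
        refine ⟨b, rfl, fun a' ha => ?_⟩
        obtain rfl : a = a' := by exact_mod_cast ha
        exact h
      · rintro ⟨b', hb, h⟩
        obtain rfl : b = b' := by exact_mod_cast hb
        exact h a rfl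

end NDA

namespace NDA

/-! ### Shortening words -/

/-- A word can be shortened without changing the state of a finite deterministic system. -/
theorem exists_short_word {S T : Type*} [Finite T] (f : List S → T)
    (hf : ∀ w w' σ, f w = f w' → f (w ++ [σ]) = f (w' ++ [σ])) (w : List S) :
    ∃ w', w'.length < Nat.card T ∧ f w' = f w := by
  have happ : ∀ v w w', f w = f w' → f (w ++ v) = f (w' ++ v) := by
    intro v
    induction v with
    | nil => simp
    | cons σ v ih =>
      intro w w' h
      simpa using ih _ _ (hf w w' σ h)
  induction hn : w.length using Nat.strong_induction_on generalizing w with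
  | _ n ih =>
    by_cases hlt : n < Nat.card T
    · exact ⟨w, hn ▸ hlt, rfl⟩
    · have := Fintype.ofFinite T
      obtain ⟨i, j, hij, he⟩ : ∃ i j : Fin (Nat.card T + 1), i ≠ j ∧
          f (w.take i) = f (w.take j) := by
        apply Fintype.exists_ne_map_eq_of_card_lt
        simp [Nat.card_eq_fintype_card]
      wlog hlt' : i < j generalizing i j
      · exact this j i hij.symm he.symm (lt_of_le_of_ne (not_lt.1 hlt') hij.symm)
      have hi : (i : ℕ) < j := hlt'
      have hj := j.2
      obtain ⟨w', h1, h2⟩ := ih (w.take i ++ w.drop j).length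
        (by rw [List.length_append, List.length_take, List.length_drop]; omega) _ rfl
      refine ⟨w', h1, h2.trans ?_⟩
      rw [happ _ _ _ he, List.take_append_drop]

section accepting

variable {S Q : Type*} (A : NDA S Q)

theorem accepting_cons_congr {z z' : List S} (h : A.accepting z = A.accepting z') (σ : S) :
    A.accepting (σ :: z) = A.accepting (σ :: z') :=
  A.accepting_append_congr h [σ]

/-- Which states accept a suffix is computed letter by letter from the right, by a deterministic
system whose states are the sets of states. -/
theorem exists_short_accepting [Finite Q] (z : List S) :
    ∃ z', z'.length < 2 ^ Nat.card Q ∧ A.accepting z' = A.accepting z := by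
  have := Fintype.ofFinite Q
  obtain ⟨w, h1, h2⟩ := exists_short_word (fun w : List S => A.accepting w.reverse)
    (fun w w' σ h => by
      simpa using A.accepting_cons_congr h σ) z.reverse
  refine ⟨w.reverse, ?_, by simpa using h2⟩
  simpa [Nat.card_eq_fintype_card] using h1

end accepting

/-! ### Relabelling states -/

section relabel

variable {S Q Q' : Type*} (A : NDA S Q)

/-- The same automaton on an equivalent type of states. -/
def relabel (e : Q ≃ Q') : NDA S Q' where
  init := {q | e.symm q ∈ A.init}
  trans p σ q := A.trans (e.symm p) σ (e.symm q)
  final q := A.final (e.symm q)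
  lam := A.lam
  one_lt_lam := A.one_lt_lam

theorem tail_relabel (e : Q ≃ Q') (z : List S) (q : Q) :
    (A.relabel e).tail z (e q) = A.tail z q := by
  induction z generalizing q with
  | nil => simp [tail, relabel]
  | cons σ z ih =>
    simp only [tail]
    refine (Equiv.iInf_congr e fun p => ?_).symm
    rw [ih]
    simp [relabel]

theorem val_relabel (e : Q ≃ Q') (w : List S) : (A.relabel e).val w = A.val w := by
  refine (Equiv.iInf_congr e fun q => ?_).symm
  rw [tail_relabel]
  have : e q ∈ (A.relabel e).init ↔ q ∈ A.init := by
    change e.symm (e q) ∈ A.init ↔ _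
    rw [e.symm_apply_apply]
  congr 1
  by_cases h : q ∈ A.init
  · rw [ind_of_mem h, ind_of_mem (this.2 h)]
  · rw [ind_of_notMem h, ind_of_notMem (this.not.2 h)]

theorem equivalent_of_val {Q' : Type*} {A : NDA S Q} {B : NDA S Q'} (hlam : A.lam = B.lam)
    (h : ∀ w, A.val w = B.val w) : A.Equivalent B := by
  intro w
  rw [value_eq, value_eq, h, unscale.eq_def, unscale.eq_def, hlam]

theorem determinizableWith_of_val {T : Type*} [Finite T] {A : NDA S Q} (D : NDA S T)
    (hlam : D.lam = A.lam) (hD : D.IsDeterministic) (h : ∀ w, D.val w = A.val w) :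
    A.DeterminizableWith A.lam := by
  have e := Finite.equivFin T
  refine ⟨Fin (Nat.card T), inferInstance, D.relabel e, hlam, ⟨?_, ?_⟩, ?_⟩
  · obtain ⟨q, hq, hu⟩ := hD.1
    refine ⟨e q, by simpa [relabel] using hq, fun y hy => ?_⟩
    rw [← hu (e.symm y) hy, Equiv.apply_symm_apply]
  · intro p σ q hq q' hq'
    exact e.symm.injective (hD.2 (e.symm p) σ hq hq')
  · exact equivalent_of_val hlam.symm fun w => by rw [val_relabel, h]

end relabel

/-! ### Capped cost vectors -/

section capped

variable {S Q : Type*} (A : NDA S Q) (B B' : ℕ)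

open Classical in
/-- The cost vector `d` without the costs that exceed the minimum by more than `B`. -/
noncomputable def trunc (d : Q → ℕ∞) (q : Q) : ℕ∞ := if d q ≤ (⨅ p, d p) + B then d q else ⊤

open Classical in
/-- The differences of the costs `d q` and the minimal cost, if they are at most `B`. -/
noncomputable def cap (d : Q → ℕ∞) (q : Q) : Option (Fin (B + 1)) :=
  if d q ≠ ⊤ ∧ d q ≤ (⨅ p, d p) + B then
    some (Fin.ofNat (B + 1) (d q - ⨅ p, d p).toNat) else none

variable {B} in
/-- The cost vector that is described by the capped differences `t`. -/
noncomputable def uncap (t : Q → Option (Fin (B + 1))) (q : Q) : ℕ∞ :=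
  optCost ((t q).map Fin.val)

theorem trunc_eq (d : Q → ℕ∞) (q : Q) : trunc B d q = (⨅ p, d p) + uncap (cap B d) q := by
  have hle : ⨅ p, d p ≤ d q := iInf_le _ q
  rw [trunc, uncap, cap]
  generalize d q = a at *
  generalize (⨅ p, d p) = i at *
  by_cases ha : a = ⊤
  · simp [ha]
  · by_cases h : a ≤ i + B
    · obtain ⟨a, rfl⟩ := lift_nat ha
      obtain ⟨i, rfl⟩ := lift_nat (ne_top_of_le_ne_top ha hle)
      have h1 : i ≤ a := by exact_mod_cast hle
      have h2 : a ≤ i + B := by exact_mod_cast h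
      rw [if_pos h, if_pos ⟨ha, h⟩, ← ENat.natCast_sub, ENat.toNat_natCast]
      have h3 : (a - i) % (B + 1) = a - i := Nat.mod_eq_of_lt (by omega)
      rw [Option.map_some, optCost_some]
      change _ = (i : ℕ∞) + (((a - i) % (B + 1) : ℕ) : ℕ∞)
      rw [h3]
      exact_mod_cast (by omega : a = i + (a - i))
    · simp [h]

theorem cap_add {C : ℕ∞} (hC : C ≠ ⊤) (d : Q → ℕ∞) : cap B (fun q => C + d q) = cap B d := by
  funext q
  have hle : ⨅ p, d p ≤ d q := iInf_le _ q
  simp only [cap, ← ENat.add_iInf]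
  generalize d q = a at *
  generalize (⨅ p, d p) = i at *
  obtain ⟨C, rfl⟩ := lift_nat hC
  by_cases ha : a = ⊤
  · simp [ha]
  · obtain ⟨a, rfl⟩ := lift_nat ha
    obtain ⟨i, rfl⟩ := lift_nat (ne_top_of_le_ne_top ha hle)
    norm_cast
    simp only [Nat.add_sub_add_left, add_assoc, add_le_add_iff_left]
    simp

theorem trunc_add (C : ℕ∞) (d : Q → ℕ∞) (q : Q) :
    trunc B (fun q => C + d q) q = C + trunc B d q := by
  by_cases hC : C = ⊤
  · simp [hC, trunc]
  · rw [trunc_eq, trunc_eq, cap_add B hC, ← ENat.add_iInf, add_assoc]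

theorem le_trunc (d : Q → ℕ∞) (q : Q) : d q ≤ trunc B d q := by
  rw [trunc]
  split_ifs <;> simp

/-- The scaled cost vector after `w` when costs that exceed the minimum by more than `B` are
dropped after each letter. -/
noncomputable def bcost (w : List S) : Q → ℕ∞ :=
  w.foldl (fun b σ => trunc B (A.step b σ)) (ind A.init)

/-- The capped differences that describe `bcost` up to an additive constant. -/
noncomputable def bstate (w : List S) : Q → Option (Fin (B + 1)) :=
  w.foldl (fun t σ => cap B (A.step (uncap t) σ)) (cap B (ind A.init))

theorem bcost_concat (w : List S) (σ : S) :
    A.bcost B (w ++ [σ]) = trunc B (A.step (A.bcost B w) σ) := by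
  simp [bcost, List.foldl_append]

theorem bstate_concat (w : List S) (σ : S) :
    A.bstate B (w ++ [σ]) = cap B (A.step (uncap (A.bstate B w)) σ) := by
  simp [bstate, List.foldl_append]

theorem icost_le_bcost (w : List S) : A.icost w ≤ A.bcost B w := by
  induction w using List.reverseRecOn with
  | nil => exact le_rfl
  | append_singleton w σ ih =>
    rw [bcost_concat, icost, cost_concat]
    exact fun q => (A.step_mono ih σ q).trans (le_trunc B _ q)

open Classical in
/-- The optional weight with a given cost. -/
noncomputable def toWeight (x : ℕ∞) : Option ℕ := if x = ⊤ then none else some x.toNat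

@[simp] theorem optCost_toWeight (x : ℕ∞) : optCost (toWeight x) = x := by
  rw [toWeight]
  split_ifs with h
  · exact h.symm
  · exact ENat.natCast_toNat h

/-- The increase of the minimal cost from the capped differences `t` on the letter `σ`. -/
noncomputable def gain (t : Q → Option (Fin (B + 1))) (σ : S) : ℕ∞ :=
  ⨅ q, ⨅ p, uncap t p + optCost (A.trans p σ q)

open Classical in
/-- The deterministic automaton whose states are the capped cost differences. -/
noncomputable def cappedDet : NDA S (Q → Option (Fin (B + 1))) where
  init := {cap B (ind A.init)}
  trans t σ t' :=
    if t' = cap B (A.step (uncap t) σ) then toWeight (A.gain B t σ) else none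
  final t := toWeight (⨅ q, uncap t q + optCost (A.final q))
  lam := A.lam
  one_lt_lam := A.one_lt_lam

theorem isDeterministic_cappedDet : (A.cappedDet B).IsDeterministic := by
  refine ⟨⟨_, rfl, fun _ h => h⟩, fun t σ => ?_⟩
  have : ∀ t', ((A.cappedDet B).trans t σ t').isSome → t' = cap B (A.step (uncap t) σ) := by
    intro t' h
    by_contra hne
    simp [cappedDet, hne] at h
  intro a ha b hb
  rw [this a ha, this b hb]

theorem iInf_step_uncap (t : Q → Option (Fin (B + 1))) (σ : S) :
    ⨅ q, A.step (uncap t) σ q = A.lam * A.gain B t σ := by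
  simp only [step, gain, ENat.mul_iInf_of_ne A.lam_ne_zero]

theorem icost_cappedDet_of_ne {w : List S} {t : Q → Option (Fin (B + 1))}
    (h : t ≠ A.bstate B w) : (A.cappedDet B).icost w t = ⊤ := by
  induction w using List.reverseRecOn generalizing t with
  | nil => exact ind_of_notMem h
  | append_singleton w σ ih =>
    rw [icost, cost_concat, ← icost, step, iInf_eq_top]
    intro t'
    by_cases ht : t' = A.bstate B w
    · subst ht
      have : (A.cappedDet B).trans (A.bstate B w) σ t = none := by
        rw [bstate_concat] at h
        exact if_neg h
      rw [this, optCost_none, add_top, ENat.mul_top (lam_ne_zero _)]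
    · rw [ih ht, top_add, ENat.mul_top (lam_ne_zero _)]

theorem icost_cappedDet_concat (w : List S) (σ : S) :
    (A.cappedDet B).icost (w ++ [σ]) (A.bstate B (w ++ [σ])) =
      A.lam * (A.cappedDet B).icost w (A.bstate B w) + A.lam * A.gain B (A.bstate B w) σ := by
  rw [icost, cost_concat, ← icost, step]
  have h1 : optCost ((A.cappedDet B).trans (A.bstate B w) σ (A.bstate B (w ++ [σ]))) =
      A.gain B (A.bstate B w) σ := by
    rw [bstate_concat]
    simp [cappedDet]
  refine le_antisymm ((iInf_le _ (A.bstate B w)).trans ?_) (le_iInf fun t => ?_)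
  · rw [h1, ← mul_add]
    exact le_rfl
  · by_cases ht : t = A.bstate B w
    · subst ht
      rw [h1, ← mul_add]
      exact le_rfl
    · rw [A.icost_cappedDet_of_ne B ht, top_add, ENat.mul_top (lam_ne_zero _)]
      exact le_top

/-- The cost of the only reachable state of the capped automaton, together with the differences in
that state, gives the capped costs. -/
theorem bcost_eq (w : List S) (q : Q) :
    A.bcost B w q = (A.cappedDet B).icost w (A.bstate B w) + uncap (A.bstate B w) q := by
  induction w using List.reverseRecOn generalizing q with
  | nil =>
    have h0 : (A.cappedDet B).icost [] (A.bstate B []) = 0 := ind_of_mem rfl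
    have h1 : ind A.init q = trunc B (ind A.init) q := by
      rw [trunc]
      by_cases h : q ∈ A.init <;> simp [h]
    change ind A.init q = _
    rw [h0, zero_add, h1, trunc_eq]
    by_cases h : (⨅ p, ind A.init p) = ⊤
    · rw [h, top_add]
      have : cap B (ind A.init) q = none := by
        have := iInf_eq_top.1 h q
        simp [cap, this]
      change ⊤ = uncap (cap B (ind A.init)) q
      rw [uncap, this]
      rfl
    · obtain ⟨p, hp⟩ := iInf_ne_top_iff.1 h
      have : (⨅ p, ind A.init p) = 0 := by
        rw [← nonpos_iff_eq_zero]
        exact (iInf_le _ p).trans (ind_of_mem (ind_ne_top.1 hp)).le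
      rw [this, zero_add]
      rfl
  | append_singleton w σ ih =>
    have h1 : A.step (A.bcost B w) σ = fun q =>
        A.lam * (A.cappedDet B).icost w (A.bstate B w) + A.step (uncap (A.bstate B w)) σ q := by
      funext q
      rw [← step_add]
      congr 1
      funext p
      exact ih p
    rw [bcost_concat, h1, trunc_add, trunc_eq, iInf_step_uncap, icost_cappedDet_concat,
      bstate_concat, add_assoc]

theorem val_cappedDet (w : List S) :
    (A.cappedDet B).val w = ⨅ q, A.bcost B w q + optCost (A.final q) := by
  have h := (A.cappedDet B).iInf_icost_add_tail w []
  simp only [List.length_nil, pow_zero, one_mul, List.append_nil] at h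
  rw [← h]
  have hf : (A.cappedDet B).tail [] (A.bstate B w) =
      ⨅ q, uncap (A.bstate B w) q + optCost (A.final q) := by
    simp [tail, cappedDet]
  have : ∀ q, A.bcost B w q + optCost (A.final q) = (A.cappedDet B).icost w (A.bstate B w) +
      (uncap (A.bstate B w) q + optCost (A.final q)) := by
    intro q
    rw [bcost_eq, add_assoc]
  simp only [this, ← ENat.add_iInf]
  rw [← hf]
  refine le_antisymm (iInf_le _ _) (le_iInf fun t => ?_)
  by_cases ht : t = A.bstate B w
  · rw [ht]
  · rw [A.icost_cappedDet_of_ne B ht, top_add]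
    exact le_top

/-- A cost that is dropped from `d` belongs to a state that accepts `z`, but no state whose cost is
within `B'` of the minimum accepts `z`. -/
def Lossy (d : Q → ℕ∞) (z : List S) : Prop :=
  (∃ q, d q ≠ ⊤ ∧ ¬ d q ≤ (⨅ p, d p) + B ∧ q ∈ A.accepting z) ∧
    ∀ l, d l ≤ (⨅ p, d p) + B' → l ∉ A.accepting z

theorem lossy_add {C : ℕ∞} (hC : C ≠ ⊤) {d : Q → ℕ∞} {z : List S} :
    A.Lossy B B' (fun q => C + d q) z ↔ A.Lossy B B' d z := by
  simp only [Lossy, ← ENat.add_iInf, add_assoc, ENat.add_le_add_iff_left hC]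
  simp [hC]

variable {B B'}

/-- Dropping costs does not change the optimum for `z` unless it is lossy. -/
theorem iInf_trunc_add_tail [Finite S] [Finite Q] (hBB : B' ≤ B)
    (hB : (B' : ℝ) + A.runBound ≤ B + 1)
    {d : Q → ℕ∞} {z : List S} (h : ¬ A.Lossy B B' d z) :
    ⨅ q, (A.lam : ℕ∞) ^ z.length * trunc B d q + A.tail z q =
      ⨅ q, (A.lam : ℕ∞) ^ z.length * d q + A.tail z q := by
  refine le_antisymm (le_iInf fun q => ?_) (iInf_mono fun q => by gcongr; exact le_trunc B d q)
  by_cases htop : (A.lam : ℕ∞) ^ z.length * d q + A.tail z q = ⊤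
  · rw [htop]
    exact le_top
  · obtain ⟨hd, hz⟩ := A.mul_pow_add_ne_top.1 htop
    by_cases hq : d q ≤ (⨅ p, d p) + B
    · refine (iInf_le _ q).trans ?_
      rw [trunc, if_pos hq]
    · -- a cheap state accepts `z` as well, and it loses at most `runBound` on `z`
      obtain ⟨l, hl, hlz⟩ : ∃ l, d l ≤ (⨅ p, d p) + B' ∧ l ∈ A.accepting z := by
        by_contra! hno
        exact h ⟨⟨q, hd, hq, hz⟩, hno⟩
      obtain ⟨k, hk⟩ := lift_nat hlz
      have hk' := A.tail_le hk
      have hi : (⨅ p, d p) ≠ ⊤ := ne_top_of_le_ne_top hd (iInf_le _ q)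
      obtain ⟨i, hi⟩ := lift_nat hi
      rw [hi] at hl hq
      obtain ⟨a, ha⟩ := lift_nat hd
      obtain ⟨b, hb⟩ := lift_nat (ne_top_of_le_ne_top (by simp) hl)
      rw [hb] at hl
      rw [ha] at hq
      have hl' : b ≤ i + B' := by exact_mod_cast hl
      have hq' : i + B + 1 ≤ a := by
        by_contra hlt
        exact hq (by exact_mod_cast (by omega : a ≤ i + B))
      refine (iInf_le _ l).trans ?_
      rw [trunc, hi, hb, if_pos (by exact_mod_cast hl'.trans (by omega)), hk, ha]
      refine le_trans ?_ le_self_add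
      have hlb : (b : ℝ) + A.runBound ≤ a := by
        have h1 : (b : ℝ) ≤ i + B' := by exact_mod_cast hl'
        have h2 : (i : ℝ) + B + 1 ≤ a := by exact_mod_cast hq'
        linarith
      have : (A.lam : ℝ) ^ z.length * b + k ≤ A.lam ^ z.length * a := by
        have := mul_le_mul_of_nonneg_left hlb (pow_nonneg A.lam_pos_real.le z.length)
        linarith
      exact_mod_cast this

/-- If no cost dropped along `w` was needed, the capped costs still determine all values. -/
theorem iInf_bcost_add_tail [Finite S] [Finite Q] (hBB : B' ≤ B)
    (hB : (B' : ℝ) + A.runBound ≤ B + 1) {w : List S}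
    (h : ∀ x σ z, x.length < w.length → ¬ A.Lossy B B' (A.step (A.bcost B x) σ) z)
    (z : List S) :
    ⨅ q, (A.lam : ℕ∞) ^ z.length * A.bcost B w q + A.tail z q = A.val (w ++ z) := by
  induction w using List.reverseRecOn generalizing z with
  | nil => exact A.iInf_icost_add_tail [] z
  | append_singleton w σ ih =>
    rw [bcost_concat, iInf_trunc_add_tail A hBB hB (h w σ z (by simp)), iInf_step_add_tail]
    have := ih (fun x σ z hx => h x σ z (hx.trans (by simp))) (σ :: z)
    simpa using this

theorem icost_cappedDet_ne_top {w : List S} {q : Q} (h : uncap (A.bstate B w) q ≠ ⊤) :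
    (A.cappedDet B).icost w (A.bstate B w) ≠ ⊤ := by
  induction w using List.reverseRecOn generalizing q with
  | nil =>
    have h0 : (A.cappedDet B).icost [] (A.bstate B []) = 0 := ind_of_mem rfl
    simp [h0]
  | append_singleton w σ ih =>
    have hg : A.gain B (A.bstate B w) σ ≠ ⊤ := by
      intro hg
      have h1 := A.iInf_step_uncap B (A.bstate B w) σ
      rw [hg, ENat.mul_top A.lam_ne_zero] at h1
      have h2 := iInf_eq_top.1 h1 q
      rw [bstate_concat, uncap, cap, if_neg (by simp [h2])] at h
      exact h rfl
    obtain ⟨r, hr⟩ := iInf_ne_top_iff.1 hg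
    obtain ⟨p, hp⟩ := iInf_ne_top_iff.1 hr
    have hC := ih (ENat.add_eq_top.not.1 hp |> not_or.1).1
    rw [icost_cappedDet_concat, ← mul_add]
    have := (A.mul_pow_add_ne_top (n := 1) (a := (A.cappedDet B).icost w (A.bstate B w) +
      A.gain B (A.bstate B w) σ) (b := 0)).2 ⟨?_, by simp⟩
    · simpa using this
    · rw [Ne, ENat.add_eq_top, not_or]
      exact ⟨hC, hg⟩

/-- What is lost in the next step depends only on the state of the capped automaton. -/
theorem lossy_step_iff {x : List S} {σ : S} {z : List S} :
    A.Lossy B B' (A.step (A.bcost B x) σ) z ↔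
      A.Lossy B B' (A.step (uncap (A.bstate B x)) σ) z := by
  have h1 : A.step (A.bcost B x) σ = fun q =>
      A.lam * (A.cappedDet B).icost x (A.bstate B x) + A.step (uncap (A.bstate B x)) σ q := by
    funext q
    rw [← step_add]
    congr 1
    funext p
    exact A.bcost_eq B x p
  rw [h1]
  by_cases hC : (A.cappedDet B).icost x (A.bstate B x) = ⊤
  · have ht : ∀ p, uncap (A.bstate B x) p = ⊤ := by
      intro p
      by_contra hp
      exact A.icost_cappedDet_ne_top hp hC
    refine iff_of_false ?_ ?_
    · rintro ⟨⟨q, hq, -⟩, -⟩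
      simp [hC, ENat.mul_top A.lam_ne_zero] at hq
    · rintro ⟨⟨q, hq, -⟩, -⟩
      simp [step, ht, ENat.mul_top A.lam_ne_zero] at hq
  · refine A.lossy_add B B' ?_
    have := (A.mul_pow_add_ne_top (n := 1) (b := 0)).2 ⟨hC, by simp⟩
    simpa using this

theorem lossy_congr {d : Q → ℕ∞} {z z' : List S} (h : A.accepting z = A.accepting z') :
    A.Lossy B B' d z ↔ A.Lossy B B' d z' := by
  simp only [Lossy, h]

/-- If `A` is not determinizable with its own discount factor, then there is a large gap, at a
short word, that is needed for an optimal run on a short continuation. -/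
theorem exists_short_gap [Finite S] [Finite Q] (hBB : B' ≤ B)
    (hB : (B' : ℝ) + A.runBound ≤ B + 1) (hA : ¬ A.DeterminizableWith A.lam) :
    ∃ (w z : List S) (q l : Q), w.length ≤ (B + 2) ^ Nat.card Q ∧ z.length < 2 ^ Nat.card Q ∧
      (A.lam : ℕ∞) ^ z.length * A.icost w q + A.tail z q = A.val (w ++ z) ∧
      A.val (w ++ z) ≠ ⊤ ∧ A.icost w l + B' < A.icost w q := by
  have := Fintype.ofFinite Q
  have hex : ∃ n, ∃ (x : List S) (σ : S) (z : List S), x.length = n ∧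
      A.Lossy B B' (A.step (A.bcost B x) σ) z := by
    by_contra! hno
    refine hA (determinizableWith_of_val (A.cappedDet B) rfl (A.isDeterministic_cappedDet B) ?_)
    intro w
    have := A.iInf_bcost_add_tail hBB hB (w := w) (fun x σ z _ => hno _ x σ z rfl) []
    rw [List.append_nil] at this
    rw [val_cappedDet, ← this]
    simp [tail]
  classical
  obtain ⟨x, σ, z₀, hx, hl₀⟩ := Nat.find_spec hex
  have hmin : ∀ x' σ z, x'.length < x.length → ¬ A.Lossy B B' (A.step (A.bcost B x') σ) z :=
    fun x' σ z hlt hl => Nat.find_min hex (hx ▸ hlt) ⟨x', σ, z, rfl, hl⟩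
  obtain ⟨z, hz, hzz⟩ := A.exists_short_accepting z₀
  have hl := (A.lossy_congr hzz.symm).1 hl₀
  have hlen : x.length < (B + 2) ^ Nat.card Q := by
    obtain ⟨x', h1, h2⟩ := exists_short_word (A.bstate B)
      (fun w w' σ h => by rw [bstate_concat, bstate_concat, h]) x
    have h3 : ¬ x'.length < x.length := by
      intro hlt
      refine hmin x' σ z hlt ?_
      rw [lossy_step_iff, h2, ← lossy_step_iff]
      exact hl
    have h4 : Nat.card (Q → Option (Fin (B + 1))) = (B + 2) ^ Nat.card Q := by
      simp [Nat.card_eq_fintype_card]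
    omega
  -- nothing needed was dropped before `x`, so an optimal run on `xσz` still shows in the costs
  have hval := A.iInf_bcost_add_tail hBB hB hmin (σ :: z)
  rw [List.length_cons, ← iInf_step_add_tail] at hval
  have hc : A.icost (x ++ [σ]) ≤ A.step (A.bcost B x) σ := by
    rw [icost, cost_concat]
    exact A.step_mono (A.icost_le_bcost B x) σ
  set d := A.step (A.bcost B x) σ with hd
  have happ : x ++ σ :: z = (x ++ [σ]) ++ z := by simp
  rw [happ] at hval
  obtain ⟨⟨u, hu, -, huz⟩, hno⟩ := hl
  have hne : A.val ((x ++ [σ]) ++ z) ≠ ⊤ := by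
    rw [← hval, iInf_ne_top_iff]
    exact ⟨u, A.mul_pow_add_ne_top.2 ⟨hu, huz⟩⟩
  obtain ⟨q, hq⟩ := exists_eq_of_iInf_ne_top (hval.trans_ne hne)
  rw [hval] at hq
  have hqt : q ∈ A.accepting z := (A.mul_pow_add_ne_top.1 (hq.trans_ne hne)).2
  have hdt : d q ≠ ⊤ := (A.mul_pow_add_ne_top.1 (hq.trans_ne hne)).1
  have hopt : (A.lam : ℕ∞) ^ z.length * A.icost (x ++ [σ]) q + A.tail z q
      = A.val ((x ++ [σ]) ++ z) :=
    le_antisymm (le_trans (by gcongr; exact hc q) hq.le) (A.val_le _ _ _)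
  have heq : A.icost (x ++ [σ]) q = d q :=
    A.eq_of_mul_pow_add_eq (hopt.trans hq.symm) (hq.trans_ne hne)
  have hinf : (⨅ s, A.icost (x ++ [σ]) s) ≠ ⊤ :=
    iInf_ne_top_iff.2 ⟨q, heq.trans_ne hdt⟩
  obtain ⟨l, hl⟩ := exists_eq_of_iInf_ne_top hinf
  refine ⟨x ++ [σ], z, q, l, by simpa using hlen, hz, hopt, hne, ?_⟩
  rw [hl, heq]
  refine lt_of_le_of_lt ?_ (not_le.1 fun h => hno q h hqt)
  gcongr
  exact hc _

end capped

end NDA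

namespace NDA

variable {S Q : Type*} (A : NDA S Q)

/-! ### Automata without a short separation are determinizable -/

theorem constN_eq : A.constN = (A.lam : ℝ) ^ (Nat.card Q ^ 2 * 2 ^ (Nat.card Q ^ 2))
    * (2 * (Nat.card Q * A.runBound)) - 2 * A.runBound := by
  rw [constN, constM_eq]
  ring

theorem constN_nonneg [Finite Q] [Nonempty Q] : 0 ≤ A.constN := by
  have h1 : (1 : ℝ) ≤ (A.lam : ℝ) ^ (Nat.card Q ^ 2 * 2 ^ (Nat.card Q ^ 2)) :=
    one_le_pow₀ A.one_lt_lam_real.le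
  have h2 : (1 : ℝ) ≤ Nat.card Q := by exact_mod_cast Nat.card_pos (α := Q)
  have h3 := A.runBound_nonneg
  have h4 : A.runBound ≤ Nat.card Q * A.runBound := le_mul_of_one_le_left h3 h2
  have h5 := le_mul_of_one_le_left (by positivity : 0 ≤ 2 * (Nat.card Q * A.runBound)) h1
  rw [constN_eq]
  linarith

theorem card_mul_constN_nonneg [Finite Q] : 0 ≤ Nat.card Q * A.constN := by
  cases isEmpty_or_nonempty Q with
  | inl h => simp
  | inr h => exact mul_nonneg (Nat.cast_nonneg _) A.constN_nonneg

/-- A state with a large cost lies above a gap between two consecutive costs. -/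
theorem exists_cut [Finite Q] {f : Q → ℕ∞} {N : ℝ} (hN : 0 ≤ N) {l q : Q} {b : ℕ}
    (hl : f l = b) (hq : ∀ a : ℕ, f q = a → b + Nat.card Q * N < a) :
    ∃ L : Set Q, l ∈ L ∧ q ∉ L ∧ ∀ u ∉ L, ∀ s ∈ L,
      ∃ b : ℕ, f s = b ∧ ∀ a : ℕ, f u = a → N + b < a := by
  have := Fintype.ofFinite Q
  -- one of `|Q|` consecutive intervals of length `N` above `b` contains no cost
  obtain ⟨i, hi⟩ : ∃ i : Fin (Nat.card Q), ∀ (s : Q) (c : ℕ), f s = c →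
      ¬ (b + i * N < c ∧ (c : ℝ) ≤ b + (i + 1) * N) := by
    by_contra! hno
    choose s c hs hc hc' using hno
    have hlt : ∀ i j, i < j → s i ≠ s j := by
      intro i j hij he
      have hcc : c i = c j := by
        have := (hs i).symm.trans ((congrArg f he).trans (hs j))
        exact_mod_cast this
      have h1 : ((i : ℕ) : ℝ) + 1 ≤ (j : ℕ) := by exact_mod_cast hij
      have h2 := mul_le_mul_of_nonneg_right h1 hN
      have h3 := hc' i
      have h4 := hc j
      rw [hcc] at h3
      linarith
    have hinj : Function.Injective s := by
      intro i j he
      rcases lt_trichotomy i j with h | h | h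
      · exact absurd he (hlt _ _ h)
      · exact h
      · exact absurd he.symm (hlt _ _ h)
    have hbij := (Fintype.bijective_iff_injective_and_card s).2
      ⟨hinj, by simp [Nat.card_eq_fintype_card]⟩
    obtain ⟨i, hi⟩ := hbij.2 l
    have hb : b = c i := by
      have := hl.symm.trans ((congrArg f hi.symm).trans (hs i))
      exact_mod_cast this
    have h1 := hc i
    have h2 : 0 ≤ (i : ℕ) * N := mul_nonneg (Nat.cast_nonneg _) hN
    rw [hb] at h1
    linarith
  refine ⟨{s | ∃ c : ℕ, f s = c ∧ (c : ℝ) ≤ b + i * N}, ⟨b, hl, ?_⟩, ?_, ?_⟩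
  · have h2 : 0 ≤ (i : ℕ) * N := mul_nonneg (Nat.cast_nonneg _) hN
    linarith
  · rintro ⟨c, hc, hle⟩
    have h1 := hq c hc
    have h2 : ((i : ℕ) : ℝ) ≤ Nat.card Q := by exact_mod_cast i.2.le
    have h3 := mul_le_mul_of_nonneg_right h2 hN
    linarith
  · rintro u hu s ⟨b', hs, hb'⟩
    refine ⟨b', hs, fun a ha => ?_⟩
    have h1 : b + i * N < a := by
      by_contra h
      exact hu ⟨a, ha, not_lt.1 h⟩
    have h2 : b + (i + 1) * N < a := by
      by_contra h
      exact hi u a ha ⟨h1, not_lt.1 h⟩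
    linarith

/-- The needed state of `exists_short_gap` has a cost more than `|Q| N` above the minimum, so that
`exists_cut` turns the gap into a short separation. -/
theorem determinizableWith_of_not_hasShortSeparation [Finite S] [Finite Q]
    (hA : ¬ A.HasShortSeparation) : A.DeterminizableWith A.lam := by
  by_contra hdet
  have hY0 := A.card_mul_constN_nonneg
  -- costs up to `Y` above the minimum are kept; a run loses at most `runBound` on a suffix, so that
  -- a needed cost that is dropped is more than `X` above the minimum
  set X : ℝ := Nat.card Q * A.constN with hX
  set Y : ℝ := (A.lam : ℝ) / ((A.lam : ℝ) - 1) *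
    (A.constN * (Nat.card Q : ℝ) + 2 * (A.maxWeight : ℝ)) with hY
  have hl1 : (0 : ℝ) < (A.lam : ℝ) - 1 := by linarith [A.one_lt_lam_real]
  have hl2 : 1 ≤ (A.lam : ℝ) / ((A.lam : ℝ) - 1) := by
    rw [le_div_iff₀ hl1]
    linarith
  have hXY : X + 2 * A.runBound ≤ Y := by
    have h1 := le_mul_of_one_le_left hY0 hl2
    have h2 : Y = (A.lam : ℝ) / ((A.lam : ℝ) - 1) * X + 2 * A.runBound := by
      rw [hY, hX, runBound]
      ring
    linarith
  have hr := A.runBound_nonneg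
  have hXf := Nat.floor_le hY0
  have hYf := Nat.lt_floor_add_one Y
  have hYf' := Nat.floor_le (hY0.trans (by linarith) : 0 ≤ Y)
  obtain ⟨w, z, q, l, hw, hz, hopt, hne, hgap⟩ := A.exists_short_gap (B := ⌊Y⌋₊)
    (B' := ⌊X⌋₊) (Nat.floor_le_floor (by linarith)) (by linarith) hdet
  have : Nonempty Q := ⟨q⟩
  have hq := (A.mul_pow_add_ne_top.1 (hopt.trans_ne hne)).1
  obtain ⟨b, hb⟩ := lift_nat (ne_top_of_lt (le_self_add.trans_lt hgap))
  obtain ⟨L, hlL, hqL, hL⟩ := exists_cut A.constN_nonneg hb (q := q) (by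
    intro a ha
    rw [hb, ha] at hgap
    have h1 : b + ⌊X⌋₊ + 1 ≤ a := by exact_mod_cast hgap
    have h2 : (b : ℝ) + ⌊X⌋₊ + 1 ≤ a := by exact_mod_cast h1
    have h3 := Nat.lt_floor_add_one X
    linarith)
  refine hA ⟨(w, z), ⟨?_, ?_⟩, Lᶜ, L, q, ⟨q, hqL⟩, ⟨l, hlL⟩, disjoint_compl_left,
    Set.compl_union_self L, fun u hu s hs => A.lt_mul_sub_iff.2 (hL u hu s hs), hqL, fun s hs => ?_⟩
  · rw [wordBound]
    calc (w.length : ℝ) ≤ ((⌊Y⌋₊ + 2) ^ Nat.card Q : ℕ) := by exact_mod_cast hw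
      _ ≤ (Y + 2) ^ Nat.card Q := by
        push_cast
        gcongr
  · exact hz.le.trans (Nat.pow_le_pow_right (by norm_num) (by omega))
  · refine A.isRecoverableGap_iff.2 ⟨?_, hopt, hne⟩
    obtain ⟨c, hc, hlt⟩ := hL q hqL s hs
    obtain ⟨a, ha⟩ := lift_nat hq
    have h1 := hlt a ha
    rw [hc, ha]
    have h2 : (c : ℝ) ≤ a := by linarith [A.constN_nonneg]
    exact_mod_cast h2

/-! ### Large gaps preclude determinization -/

theorem eq_of_icost_ne_top_of_isDeterministic (hA : A.IsDeterministic) (w : List S) {s t : Q}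
    (hs : A.icost w s ≠ ⊤) (ht : A.icost w t ≠ ⊤) : s = t := by
  induction w using List.reverseRecOn generalizing s t with
  | nil => exact hA.1.unique (ind_ne_top.1 hs) (ind_ne_top.1 ht)
  | append_singleton w σ ih =>
    have key : ∀ s, A.icost (w ++ [σ]) s ≠ ⊤ →
        ∃ p, A.icost w p ≠ ⊤ ∧ (A.trans p σ s).isSome := by
      intro s hs
      rw [icost, cost_concat, ← icost, step, iInf_ne_top_iff] at hs
      obtain ⟨p, hp⟩ := hs
      have := (A.mul_pow_add_ne_top (n := 1) (b := 0)).1 (by simpa using hp)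
      have h2 := not_or.1 (ENat.add_eq_top.not.1 this.1)
      exact ⟨p, h2.1, optCost_ne_top.1 h2.2⟩
    obtain ⟨p, hp, hps⟩ := key s hs
    obtain ⟨p', hp', hpt⟩ := key t ht
    obtain rfl := ih hp hp'
    exact hA.2 p σ hps hpt

/-- The values of two continuations of a word differ by a bounded amount after scaling. -/
theorem div_le_div_add_of_isDeterministic [Finite S] [Finite Q] (hA : A.IsDeterministic)
    {u z z' : List S} {k k' : ℕ} (h : A.val (u ++ z) = k) (h' : A.val (u ++ z') = k') :
    (k : ℝ) / A.lam ^ (u ++ z).length ≤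
      k' / A.lam ^ (u ++ z').length + A.runBound / A.lam ^ u.length := by
  have key : ∀ (z : List S) (k : ℕ), A.val (u ++ z) = k → ∃ (s : Q) (c f : ℕ),
      A.icost u s = c ∧ A.tail z s = f ∧ A.lam ^ z.length * c + f = k := by
    intro z k hk
    rw [← iInf_icost_add_tail] at hk
    obtain ⟨s, hs⟩ := exists_eq_of_iInf_ne_top (hk.trans_ne (ENat.natCast_ne_top k))
    exact ⟨s, A.mul_pow_add_eq_coe.1 (hs.trans hk)⟩
  obtain ⟨s, c, f, h1, h2, rfl⟩ := key z k h
  obtain ⟨s', c', f', h1', h2', rfl⟩ := key z' k' h'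
  obtain rfl : s = s' := A.eq_of_icost_ne_top_of_isDeterministic hA u
    (h1.trans_ne (ENat.natCast_ne_top _)) (h1'.trans_ne (ENat.natCast_ne_top _))
  obtain rfl : c = c' := by exact_mod_cast h1.symm.trans h1'
  have h3 := A.tail_le h2
  have hu : (0 : ℝ) < A.lam ^ u.length := pow_pos A.lam_pos_real _
  have hz : (0 : ℝ) < A.lam ^ z.length := pow_pos A.lam_pos_real _
  have hz' : (0 : ℝ) < A.lam ^ z'.length := pow_pos A.lam_pos_real _
  rw [List.length_append, List.length_append, pow_add, pow_add]
  have e1 : ((A.lam ^ z.length * c + f : ℕ) : ℝ) / ((A.lam : ℝ) ^ u.length * A.lam ^ z.length) =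
      (c + f / A.lam ^ z.length) / A.lam ^ u.length := by
    push_cast
    field_simp
  have e2 : ((A.lam ^ z'.length * c + f' : ℕ) : ℝ) / ((A.lam : ℝ) ^ u.length * A.lam ^ z'.length) =
      (c + f' / A.lam ^ z'.length) / A.lam ^ u.length := by
    push_cast
    field_simp
  rw [e1, e2, ← add_div]
  have h4 : (f : ℝ) / A.lam ^ z.length ≤ A.runBound := (div_le_iff₀ hz).2 h3
  have h5 : 0 ≤ (f' : ℝ) / A.lam ^ z'.length := by positivity
  gcongr
  linarith

theorem val_of_equivalent {Q' : Type*} {D : NDA S Q'} (h : A.Equivalent D) {w : List S} {k : ℕ}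
    (hk : A.val w = k) :
    ∃ k' : ℕ, D.val w = k' ∧ (k' : ℝ) / D.lam ^ w.length = k / A.lam ^ w.length := by
  have h1 := h w
  rw [value_eq, value_eq, hk, unscale_coe] at h1
  have h2 : D.val w ≠ ⊤ := by
    rw [← unscale_lt_top, ← h1]
    exact EReal.coe_lt_top _
  obtain ⟨k', hk'⟩ := lift_nat h2
  rw [hk', unscale_coe] at h1
  exact ⟨k', hk', by exact_mod_cast h1.symm⟩

/-- The states from which some continuation of `y` is accepted. -/
def alive (y : List S) : Set Q := {p | ∃ z, p ∈ A.accepting (y ++ z)}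

theorem alive_append_congr {u u' : List S} (h : A.alive u = A.alive u') (y : List S) :
    A.alive (y ++ u) = A.alive (y ++ u') := by
  have key : ∀ u p, p ∈ A.alive (y ++ u) ↔ ∃ r, A.wt y p r ≠ ⊤ ∧ r ∈ A.alive u := by
    intro u p
    simp only [alive, Set.mem_ofPred_eq, List.append_assoc, A.mem_accepting_append (w := y)]
    constructor
    · rintro ⟨z, r, h1, h2⟩
      exact ⟨r, h1, z, h2⟩
    · rintro ⟨r, h1, z, h2⟩
      exact ⟨z, r, h1, h2⟩
  ext p
  rw [key, key, h]

/-- An optimal run on `xy` splits after `x`. -/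
theorem exists_icost_prefix {x y : List S} {l : Q} {b : ℕ} (h : A.icost (x ++ y) l = b) :
    ∃ (p : Q) (c : ℕ), A.icost x p = c ∧ A.lam ^ y.length * c ≤ b ∧ A.wt y p l ≠ ⊤ := by
  rw [icost_append, cost_eq_iInf] at h
  obtain ⟨p, hp⟩ := exists_eq_of_iInf_ne_top (h.trans_ne (ENat.natCast_ne_top b))
  rw [h] at hp
  obtain ⟨c, k, h1, h2, rfl⟩ := A.mul_pow_add_eq_coe.1 hp
  exact ⟨p, c, h1, by omega, h2.trans_ne (ENat.natCast_ne_top k)⟩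

/-- A gap that exceeds `N` at `w = xy` comes from a gap that exceeds the weight of any run at each
of the last prefixes `x`. -/
theorem gap_at_prefix [Finite S] [Finite Q] (hn : 2 ≤ Nat.card Q) {x y z : List S} {q : Q}
    {a b : ℕ} (hq : A.icost (x ++ y) q = a) (hgap : A.constN + b < a)
    (hopt : (A.lam : ℕ∞) ^ z.length * A.icost (x ++ y) q + A.tail z q = A.val (x ++ y ++ z))
    (hy : y.length ≤ Nat.card Q ^ 2 * 2 ^ (Nat.card Q ^ 2)) {p : Q} {c c' : ℕ}
    (hc : A.icost x p = c) (hp : p ∈ A.accepting (y ++ z)) (hc' : A.lam ^ y.length * c' ≤ b) :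
    c' + A.runBound < c := by
  obtain ⟨r, hr, hrz⟩ := A.mem_accepting_append.1 hp
  obtain ⟨k, hk⟩ := lift_nat hr
  obtain ⟨f, hf⟩ := lift_nat hrz
  have hk' := A.wt_le hk
  have hf' := A.tail_le hf
  have h1 : A.icost (x ++ y) r ≤ ((A.lam ^ y.length * c + k : ℕ) : ℕ∞) := by
    rw [icost_append, cost_eq_iInf]
    refine (iInf_le _ p).trans ?_
    rw [hc, hk]
    push_cast
    exact le_rfl
  have h2 : ((A.lam ^ z.length * a : ℕ) : ℕ∞) ≤
      ((A.lam ^ z.length * (A.lam ^ y.length * c + k) + f : ℕ) : ℕ∞) := by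
    calc ((A.lam ^ z.length * a : ℕ) : ℕ∞)
        ≤ (A.lam : ℕ∞) ^ z.length * A.icost (x ++ y) q + A.tail z q := by
          rw [hq]
          push_cast
          exact le_self_add
      _ ≤ (A.lam : ℕ∞) ^ z.length * A.icost (x ++ y) r + A.tail z r := by
          rw [hopt]
          exact A.val_le _ _ _
      _ ≤ _ := by
          rw [hf]
          push_cast at h1 ⊢
          gcongr
  have h3 : (A.lam : ℝ) ^ z.length * a ≤
      A.lam ^ z.length * (A.lam ^ y.length * c + k) + f := by exact_mod_cast h2
  have hz : (0 : ℝ) < A.lam ^ z.length := pow_pos A.lam_pos_real _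
  have hyp : (0 : ℝ) < A.lam ^ y.length := pow_pos A.lam_pos_real _
  have h4 : (a : ℝ) ≤ A.lam ^ y.length * (c + A.runBound) := by
    refine le_of_mul_le_mul_left ?_ hz
    have := mul_le_mul_of_nonneg_left hk' hz.le
    linarith
  have h5 : (A.lam : ℝ) ^ y.length * c' ≤ b := by exact_mod_cast hc'
  -- the factor `|Q| ≥ 2` in `constN` pays for the weights of the runs on `y` and on `z`
  have h6 : (A.lam : ℝ) ^ y.length * (2 * A.runBound) ≤ A.constN := by
    have hr := A.runBound_nonneg
    have e1 : (A.lam : ℝ) ^ y.length ≤ A.lam ^ (Nat.card Q ^ 2 * 2 ^ (Nat.card Q ^ 2)) :=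
      pow_le_pow_right₀ A.one_lt_lam_real.le hy
    have e2 : (1 : ℝ) ≤ A.lam ^ (Nat.card Q ^ 2 * 2 ^ (Nat.card Q ^ 2)) :=
      one_le_pow₀ A.one_lt_lam_real.le
    have e3 : (2 : ℝ) ≤ Nat.card Q := by exact_mod_cast hn
    rw [constN_eq]
    generalize (A.lam : ℝ) ^ (Nat.card Q ^ 2 * 2 ^ (Nat.card Q ^ 2)) = K at *
    have e4 : 2 * A.runBound ≤ Nat.card Q * A.runBound := mul_le_mul_of_nonneg_right e3 hr
    have e5 : K * (2 * (2 * A.runBound)) ≤ K * (2 * (Nat.card Q * A.runBound)) := by gcongr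
    have e6 : (A.lam : ℝ) ^ y.length * (2 * A.runBound) ≤ K * (2 * A.runBound) := by gcongr
    have e7 : 2 * A.runBound ≤ K * (2 * A.runBound) :=
      le_mul_of_one_le_left (by linarith) e2
    linarith
  have h7 : (A.lam : ℝ) ^ y.length * (c' + A.runBound) < A.lam ^ y.length * c := by linarith
  exact lt_of_mul_lt_mul_left h7 hyp.le

/-- There are fewer pairs of sets of states than prefixes controlled by `constN`. -/
theorem two_pow_lt_of_two_le {n : ℕ} (hn : 2 ≤ n) : 2 ^ n * 2 ^ n < n ^ 2 * 2 ^ (n ^ 2) + 1 := by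
  have h1 : 2 ^ n * 2 ^ n ≤ 2 ^ (n ^ 2) := by
    rw [← pow_add]
    exact Nat.pow_le_pow_right (by norm_num) (by nlinarith)
  have h2 : 2 ^ (n ^ 2) ≤ n ^ 2 * 2 ^ (n ^ 2) := Nat.le_mul_of_pos_left _ (by positivity)
  omega

/-- Inserting a factor `y` repeatedly keeps the gap between `p'` and the states that are needed for
`z`: a deterministic automaton cannot follow the values of both kinds of continuations. -/
theorem not_determinizable_of_pumping [Finite S] [Finite Q] {x z : List S} {v : ℕ → List S}
    (hv : ∀ t, t ≤ (v t).length) {p' : Q} {c' : ℕ} (hc' : A.icost x p' = c')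
    (halive : ∀ t, p' ∈ A.alive (v t)) {P : Set Q} (hP : ∀ t, A.accepting (v t ++ z) = P)
    (hPne : ∃ p ∈ P, A.icost x p ≠ ⊤)
    (hgap : ∀ p ∈ P, ∀ c : ℕ, A.icost x p = c → c' + A.runBound < c) :
    ¬ A.Determinizable := by
  rintro ⟨Q', _, D, hD, heq⟩
  -- the cheapest needed state fixes the size of the gap for all `v t` at once
  obtain ⟨p₁, hp₁, hp₁t⟩ := hPne
  obtain ⟨p₀, hp₀, hmin⟩ := Set.exists_min_image P (A.icost x) P.toFinite ⟨p₁, hp₁⟩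
  obtain ⟨c₀, hc₀⟩ := lift_nat (ne_top_of_le_ne_top hp₁t (hmin p₁ hp₁))
  have hlt := hgap p₀ hp₀ c₀ hc₀
  have hx : (0 : ℝ) < A.lam ^ x.length := pow_pos A.lam_pos_real _
  have hbound : ∀ t : ℕ,
      (c₀ - c' - A.runBound) / A.lam ^ x.length ≤ D.runBound * (1 / 2 : ℝ) ^ t := by
    intro t
    have h1 : A.val (x ++ (v t ++ z)) ≠ ⊤ := by
      rw [← iInf_icost_add_tail, iInf_ne_top_iff]
      exact ⟨p₀, A.mul_pow_add_ne_top.2 ⟨hc₀.trans_ne (ENat.natCast_ne_top _),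
        (hP t ▸ hp₀ : p₀ ∈ A.accepting (v t ++ z))⟩⟩
    obtain ⟨k, hk⟩ := lift_nat h1
    have hk1 : A.lam ^ (v t ++ z).length * c₀ ≤ k := by
      have h := hk
      rw [← iInf_icost_add_tail] at h
      obtain ⟨s, hs⟩ := exists_eq_of_iInf_ne_top (h.trans_ne (ENat.natCast_ne_top k))
      obtain ⟨c, f, h2, h3, h4⟩ := A.mul_pow_add_eq_coe.1 (hs.trans h)
      have hsP : s ∈ P := by
        rw [← hP t]
        exact h3.trans_ne (ENat.natCast_ne_top f)
      have := hmin s hsP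
      rw [h2, hc₀] at this
      have h5 : c₀ ≤ c := by exact_mod_cast this
      calc _ ≤ A.lam ^ (v t ++ z).length * c := Nat.mul_le_mul_left _ h5
        _ ≤ k := by omega
    obtain ⟨z', hz'⟩ := halive t
    obtain ⟨f, hf⟩ := lift_nat hz'
    have hf' := A.tail_le hf
    have h2 : A.val (x ++ (v t ++ z')) ≤ ((A.lam ^ (v t ++ z').length * c' + f : ℕ) : ℕ∞) := by
      refine (A.val_le _ _ p').trans ?_
      rw [hc', hf]
      push_cast
      exact le_rfl
    obtain ⟨k', hk'⟩ := lift_nat (ne_top_of_le_ne_top (ENat.natCast_ne_top _) h2)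
    rw [hk'] at h2
    have hk1' : k' ≤ A.lam ^ (v t ++ z').length * c' + f := by exact_mod_cast h2
    obtain ⟨e, he, hek⟩ := A.val_of_equivalent heq hk
    obtain ⟨e', he', hek'⟩ := A.val_of_equivalent heq hk'
    rw [← List.append_assoc] at he he'
    have h3 := D.div_le_div_add_of_isDeterministic hD he he'
    rw [List.append_assoc, List.append_assoc, hek, hek'] at h3
    have hvz : (0 : ℝ) < A.lam ^ (v t ++ z).length := pow_pos A.lam_pos_real _
    have hvz' : (0 : ℝ) < A.lam ^ (v t ++ z').length := pow_pos A.lam_pos_real _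
    have h4 : (c₀ : ℝ) / A.lam ^ x.length ≤ k / A.lam ^ (x ++ (v t ++ z)).length := by
      rw [List.length_append, pow_add, div_le_div_iff₀ hx (mul_pos hx hvz)]
      have : (A.lam : ℝ) ^ (v t ++ z).length * c₀ ≤ k := by exact_mod_cast hk1
      nlinarith
    have h5 : (k' : ℝ) / A.lam ^ (x ++ (v t ++ z')).length ≤
        (c' + A.runBound) / A.lam ^ x.length := by
      rw [List.length_append, pow_add, div_le_div_iff₀ (mul_pos hx hvz') hx]
      have : (k' : ℝ) ≤ A.lam ^ (v t ++ z').length * c' + f := by exact_mod_cast hk1'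
      nlinarith
    have h6 : D.runBound / (D.lam : ℝ) ^ (x ++ v t).length ≤ D.runBound * (1 / 2 : ℝ) ^ t := by
      rw [div_eq_mul_inv]
      refine mul_le_mul_of_nonneg_left ?_ D.runBound_nonneg
      rw [one_div, inv_pow]
      refine inv_anti₀ (by positivity) ?_
      calc (2 : ℝ) ^ t ≤ 2 ^ (x ++ v t).length := by
            refine pow_le_pow_right₀ (by norm_num) ?_
            rw [List.length_append]
            have := hv t
            omega
        _ ≤ (D.lam : ℝ) ^ (x ++ v t).length := by
            gcongr
            exact D.two_le_lam_real
    have h7 : (c₀ - c' - A.runBound) / (A.lam : ℝ) ^ x.length =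
        c₀ / A.lam ^ x.length - (c' + A.runBound) / A.lam ^ x.length := by ring
    linarith
  have hδ : 0 < (c₀ - c' - A.runBound) / (A.lam : ℝ) ^ x.length := div_pos (by linarith) hx
  obtain ⟨t, ht⟩ := exists_pow_lt_of_lt_one (div_pos hδ (by
    linarith [D.runBound_nonneg] : 0 < D.runBound + 1)) (by norm_num : (1 / 2 : ℝ) < 1)
  rw [lt_div_iff₀ (by linarith [D.runBound_nonneg])] at ht
  have h1 := hbound t
  have h2 : (0 : ℝ) ≤ (1 / 2) ^ t := by positivity
  linarith

/-- A gap larger than `N` above a state that accepts some suffix, at a state that is needed for an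
optimal run, precludes determinization: such gaps can be pumped. -/
theorem not_determinizable_of_gap [Finite S] [Finite Q] {w z : List S} {q l : Q} {a b : ℕ}
    (hl : A.icost w l = b) (hq : A.icost w q = a) (hgap : A.constN + b < a)
    (hopt : (A.lam : ℕ∞) ^ z.length * A.icost w q + A.tail z q = A.val (w ++ z))
    (hne : A.val (w ++ z) ≠ ⊤) (hco : A.CoReachable l) : ¬ A.Determinizable := by
  have : Nonempty Q := ⟨q⟩
  have := Fintype.ofFinite Q
  obtain ⟨zl, hzl⟩ := A.coReachable_iff.1 hco
  have hqz : q ∈ A.accepting z := (A.mul_pow_add_ne_top.1 (hopt.trans_ne hne)).2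
  have hn : 2 ≤ Nat.card Q := by
    have : q ≠ l := by
      rintro rfl
      have h1 : a = b := by exact_mod_cast hq.symm.trans hl
      rw [h1] at hgap
      linarith [A.constN_nonneg]
    have := (Fintype.one_lt_card_iff_nontrivial (α := Q)).2 ⟨q, l, this⟩
    rw [Nat.card_eq_fintype_card]
    omega
  set K := Nat.card Q ^ 2 * 2 ^ (Nat.card Q ^ 2) with hK
  have hKw : K ≤ w.length := by
    by_contra hlt
    obtain ⟨p, c, h1, h2, h3⟩ := A.exists_icost_prefix (x := []) (y := w) (hq : _ = _)
    obtain ⟨p', c', h1', h2', h3'⟩ := A.exists_icost_prefix (x := []) (y := w) (hl : _ = _)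
    -- the empty prefix has no gap
    have h4 := A.gap_at_prefix hn (x := []) (y := w) hq hgap hopt (by omega) h1
      (A.mem_accepting_append.2 ⟨q, h3, hqz⟩) h2'
    have h5 : ind A.init p = c := h1
    rw [ind_of_mem (ind_ne_top.1 (h5.trans_ne (ENat.natCast_ne_top c)))] at h5
    have h6 : c = 0 := by exact_mod_cast h5.symm
    have h7 : (0 : ℝ) ≤ c' := Nat.cast_nonneg _
    rw [h6] at h4
    push_cast at h4
    linarith [A.runBound_nonneg]
  -- two suffixes of `w` agree on which states accept `z` after them and which stay alive
  obtain ⟨i, j, hij, he⟩ : ∃ i j : Fin (K + 1), i ≠ j ∧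
      (A.accepting (w.drop (w.length - i) ++ z), A.alive (w.drop (w.length - i))) =
      (A.accepting (w.drop (w.length - j) ++ z), A.alive (w.drop (w.length - j))) := by
    apply Fintype.exists_ne_map_eq_of_card_lt
      (fun i : Fin (K + 1) =>
        (A.accepting (w.drop (w.length - i) ++ z), A.alive (w.drop (w.length - i))))
    rw [Fintype.card_prod, Fintype.card_set, Fintype.card_fin, hK, ← Nat.card_eq_fintype_card]
    exact two_pow_lt_of_two_le hn
  wlog hlt' : i < j generalizing i j
  · exact this j i hij.symm he.symm (lt_of_le_of_ne (not_lt.1 hlt') hij.symm)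
  have hlt : (i : ℕ) < j := hlt'
  have hj := j.2
  obtain ⟨x, y, y', hw, hy0, hyK, hacc, hal⟩ : ∃ x y y' : List S, w = x ++ (y ++ y') ∧
      1 ≤ y.length ∧ (y ++ y').length ≤ K ∧
      A.accepting (y' ++ z) = A.accepting (y ++ (y' ++ z)) ∧ A.alive y' = A.alive (y ++ y') := by
    have hy : (w.drop (w.length - j)).take (j - i) ++ w.drop (w.length - i) =
        w.drop (w.length - j) := by
      have : w.drop (w.length - i) = (w.drop (w.length - j)).drop (j - i) := by
        rw [List.drop_drop]
        congr 1
        omega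
      rw [this, List.take_append_drop]
    refine ⟨w.take (w.length - j), (w.drop (w.length - j)).take (j - i), w.drop (w.length - i),
      ?_, ?_, ?_, ?_, ?_⟩
    · rw [hy, List.take_append_drop]
    · rw [List.length_take, List.length_drop]
      omega
    · rw [hy, List.length_drop]
      omega
    · rw [← List.append_assoc, hy]
      exact (Prod.ext_iff.1 he).1
    · rw [hy]
      exact (Prod.ext_iff.1 he).2
  subst hw
  set v : ℕ → List S := fun t => (y ++ ·)^[t] (y ++ y') with hv
  have hvs : ∀ t, v (t + 1) = y ++ v t := fun t => Function.iterate_succ_apply' _ _ _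
  have hvacc : ∀ t, A.accepting (v t ++ z) = A.accepting ((y ++ y') ++ z) := by
    intro t
    induction t with
    | zero => rfl
    | succ t ih =>
      rw [hvs, List.append_assoc, A.accepting_append_congr ih, List.append_assoc,
        A.accepting_append_congr hacc.symm]
  have hval : ∀ t, A.alive (v t) = A.alive (y ++ y') := by
    intro t
    induction t with
    | zero => rfl
    | succ t ih => rw [hvs, A.alive_append_congr ih, A.alive_append_congr hal.symm]
  obtain ⟨p', c', h1', h2', h3'⟩ := A.exists_icost_prefix hl
  obtain ⟨p, c, h1, h2, h3⟩ := A.exists_icost_prefix hq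
  refine A.not_determinizable_of_pumping (v := v) (x := x) (z := z) ?_ h1' ?_ hvacc
    ⟨p, A.mem_accepting_append.2 ⟨q, h3, hqz⟩, h1.trans_ne (ENat.natCast_ne_top c)⟩ ?_
  · intro t
    induction t with
    | zero => exact Nat.zero_le _
    | succ t ih =>
      rw [hvs, List.length_append]
      omega
  · intro t
    rw [hval]
    exact ⟨zl, A.mem_accepting_append.2 ⟨l, h3', hzl⟩⟩
  · intro s hs e hse
    exact A.gap_at_prefix hn hq hgap hopt hyK hse hs h2'

theorem not_determinizable_of_hasShortSeparation [Finite S] [Finite Q]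
    (hco : ∀ q, A.Reachable q → A.CoReachable q) (h : A.HasShortSeparation) :
    ¬ A.Determinizable := by
  obtain ⟨⟨w, z⟩, -, U, L, qu, -, ⟨l, hl⟩, -, -, hsep, hqu, hgap⟩ := h
  obtain ⟨b, hb, hlt⟩ := A.lt_mul_sub_iff.1 (hsep qu hqu l hl)
  obtain ⟨-, hopt, hne⟩ := A.isRecoverableGap_iff.1 (hgap l hl)
  obtain ⟨a, ha⟩ := lift_nat (A.mul_pow_add_ne_top.1 (hopt.trans_ne hne)).1
  exact A.not_determinizable_of_gap hb ha (hlt a ha) hopt hne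
    (hco l (A.reachable_iff.2 ⟨w, hb.trans_ne (ENat.natCast_ne_top b)⟩))

end NDA

namespace NDA

variable {S Q : Type*} (A : NDA S Q)

/-! ### Trimming -/

theorem coReachable_of_isSome {p : Q} {σ : S} {q : Q} (h : (A.trans p σ q).isSome)
    (hq : A.CoReachable q) : A.CoReachable p := by
  rw [coReachable_iff] at hq ⊢
  obtain ⟨z, hz⟩ := hq
  refine ⟨σ :: z, iInf_ne_top_iff.2 ⟨q, A.mul_pow_add_ne_top.2 ⟨optCost_ne_top.2 h, hz⟩⟩⟩

theorem tail_eq_top_of_not_coReachable {q : Q} (h : ¬ A.CoReachable q) (z : List S) :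
    A.tail z q = ⊤ := by
  by_contra hne
  exact h (A.coReachable_iff.2 ⟨z, hne⟩)

theorem tail_trim (z : List S) (q : {q : Q // A.CoReachable q}) :
    A.trim.tail z q = A.tail z q.1 := by
  induction z generalizing q with
  | nil => rfl
  | cons σ z ih =>
    simp only [tail, ih]
    refine le_antisymm (le_iInf fun p => ?_) (le_iInf fun p => iInf_le _ p.1)
    by_cases hp : A.CoReachable p
    · exact iInf_le _ (⟨p, hp⟩ : {q : Q // A.CoReachable q})
    · rw [A.tail_eq_top_of_not_coReachable hp, add_top]
      exact le_top

theorem ind_trim (q : {q : Q // A.CoReachable q}) : ind A.trim.init q = ind A.init q.1 := rfl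

theorem val_trim (w : List S) : A.trim.val w = A.val w := by
  simp only [val, tail_trim, ind_trim]
  refine le_antisymm (le_iInf fun p => ?_) (le_iInf fun p => iInf_le _ p.1)
  by_cases hp : A.CoReachable p
  · exact iInf_le _ (⟨p, hp⟩ : {q : Q // A.CoReachable q})
  · rw [A.tail_eq_top_of_not_coReachable hp, add_top]
    exact le_top

theorem icost_trim (w : List S) (q : {q : Q // A.CoReachable q}) :
    A.trim.icost w q = A.icost w q.1 := by
  induction w using List.reverseRecOn generalizing q with
  | nil => rfl
  | append_singleton w σ ih =>
    rw [icost, icost, cost_concat, cost_concat, ← icost, ← icost]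
    simp only [step, ih]
    refine le_antisymm (le_iInf fun p => ?_) (le_iInf fun p => iInf_le _ p.1)
    by_cases hp : A.CoReachable p
    · exact iInf_le _ (⟨p, hp⟩ : {q : Q // A.CoReachable q})
    · have : A.trans p σ q = none := by
        by_contra h
        exact hp (A.coReachable_of_isSome (Option.ne_none_iff_isSome.1 h) q.2)
      rw [this, optCost_none, add_top, ENat.mul_top A.lam_ne_zero]
      exact le_top

theorem coReachable_trim (q : {q : Q // A.CoReachable q}) : A.trim.CoReachable q := by
  obtain ⟨z, hz⟩ := A.coReachable_iff.1 q.2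
  refine A.trim.coReachable_iff.2 ⟨z, ?_⟩
  rw [accepting, Set.mem_ofPred_eq, tail_trim]
  exact hz

theorem equivalent_trim : A.trim.Equivalent A := equivalent_of_val rfl A.val_trim

theorem determinizable_trim_iff : A.trim.Determinizable ↔ A.Determinizable := by
  refine ⟨?_, ?_⟩ <;> rintro ⟨Q', hQ', D, hD, h⟩ <;> refine ⟨Q', hQ', D, hD, fun w => ?_⟩
  · rw [← A.equivalent_trim w, h w]
  · rw [A.equivalent_trim w, h w]

theorem determinizableWith_trim_iff {μ : ℕ} :
    A.trim.DeterminizableWith μ ↔ A.DeterminizableWith μ := by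
  refine ⟨?_, ?_⟩ <;> rintro ⟨Q', hQ', D, hμ, hD, h⟩ <;>
    refine ⟨Q', hQ', D, hμ, hD, fun w => ?_⟩
  · rw [← A.equivalent_trim w, h w]
  · rw [A.equivalent_trim w, h w]

variable {A} in
theorem DeterminizableWith.determinizable {μ : ℕ} (h : A.DeterminizableWith μ) :
    A.Determinizable := by
  obtain ⟨Q', hQ', D, -, hD, h⟩ := h
  exact ⟨Q', hQ', D, hD, h⟩

theorem determinizable_iff [Finite S] [Finite Q] (hco : ∀ q, A.Reachable q → A.CoReachable q) :
    A.Determinizable ↔ ¬ A.HasShortSeparation :=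
  ⟨fun hd hs => A.not_determinizable_of_hasShortSeparation hco hs hd,
    fun h => (A.determinizableWith_of_not_hasShortSeparation h).determinizable⟩

theorem determinizable_iff_trim [Finite S] [Finite Q] :
    A.Determinizable ↔ ¬ A.trim.HasShortSeparation := by
  rw [← determinizable_trim_iff]
  exact A.trim.determinizable_iff fun q _ => A.coReachable_trim q

theorem determinizable_iff_determinizableWith [Finite S] [Finite Q] :
    A.Determinizable ↔ A.DeterminizableWith A.lam := by
  refine ⟨fun h => ?_, fun h => h.determinizable⟩
  rw [determinizable_iff_trim] at h
  exact A.determinizableWith_trim_iff.1 (A.trim.determinizableWith_of_not_hasShortSeparation h)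

theorem finite_shortPairs [Finite S] : A.shortPairs.Finite := by
  refine ((List.finite_length_le S ⌊A.wordBound⌋₊).prod
    (List.finite_length_le S (2 ^ (2 * Nat.card Q)))).subset ?_
  rintro ⟨w, z⟩ ⟨hw, hz⟩
  exact ⟨Nat.le_floor hw, hz⟩

/-! ### A criterion over all words of bounded length -/

/-- Among the words of length at most `W` there are a word `w` with a cost difference larger than
`X`, a suffix for which the more expensive state is needed, and a suffix that the cheaper state
accepts. -/
def HasGapWithin (X W : ℕ) : Prop :=
  ∃ w z z' : List S, w.length ≤ W ∧ z.length ≤ W ∧ z'.length ≤ W ∧ ∃ q l : Q,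
    (A.lam : ℕ∞) ^ z.length * A.icost w q + A.tail z q = A.val (w ++ z) ∧
    A.val (w ++ z) ≠ ⊤ ∧ A.icost w l + X < A.icost w q ∧ l ∈ A.accepting z'

theorem maxWeight_trim_le [Finite S] [Finite Q] : A.trim.maxWeight ≤ A.maxWeight := by
  refine csSup_le' ?_
  rintro c (⟨p, σ, q, h⟩ | ⟨q, h⟩)
  · exact A.trans_le_maxWeight h
  · exact A.final_le_maxWeight h

/-- The characterization holds with all larger bounds, and without trimming: the acceptance of a
suffix by the cheaper state takes the role of trimming. -/
theorem determinizable_iff_not_hasGapWithin [Finite S] [Finite Q] {X W m : ℕ}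
    (hm : A.maxWeight ≤ m) (hX : A.constN ≤ X) (hW : (X + 2 * m + 2) ^ Nat.card Q ≤ W)
    (hW' : 2 ^ Nat.card Q ≤ W) : A.Determinizable ↔ ¬ A.HasGapWithin X W := by
  constructor
  · rintro hd ⟨w, z, z', -, -, -, q, l, hopt, hne, hgap, hl⟩
    obtain ⟨a, ha⟩ := lift_nat (A.mul_pow_add_ne_top.1 (hopt.trans_ne hne)).1
    obtain ⟨b, hb⟩ := lift_nat (ne_top_of_lt (le_self_add.trans_lt hgap))
    refine A.not_determinizable_of_gap hb ha ?_ hopt hne (A.coReachable_iff.2 ⟨z', hl⟩) hd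
    rw [ha, hb] at hgap
    have h1 : b + X < a := by exact_mod_cast hgap
    have h2 : (b : ℝ) + X < a := by exact_mod_cast h1
    linarith
  · intro hno
    rw [determinizable_iff_determinizableWith]
    by_contra hd
    have hr : A.trim.runBound ≤ 2 * m := by
      have h1 := A.trim.runBound_le
      have h2 : (A.trim.maxWeight : ℝ) ≤ m := by exact_mod_cast A.maxWeight_trim_le.trans hm
      linarith
    have hcard : Nat.card {q : Q // A.CoReachable q} ≤ Nat.card Q :=
      Nat.card_le_card_of_injective _ Subtype.val_injective
    obtain ⟨w, z, q, l, hw, hz, hopt, hne, hgap⟩ := A.trim.exists_short_gap (B := X + 2 * m)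
      (B' := X) (by omega) (by push_cast; linarith)
      (fun h => hd (A.determinizableWith_trim_iff.1 h))
    obtain ⟨z₀, hz₀⟩ := A.coReachable_iff.1 l.2
    obtain ⟨z', hz', hzz⟩ := A.exists_short_accepting z₀
    refine hno ⟨w, z, z', ?_, ?_, hz'.le.trans hW', q, l, ?_, ?_, ?_, hzz ▸ hz₀⟩
    · exact hw.trans ((Nat.pow_le_pow_right (by omega) hcard).trans hW)
    · exact hz.le.trans ((Nat.pow_le_pow_right (by omega) hcard).trans hW')
    · rw [← icost_trim, ← tail_trim, ← val_trim]
      exact hopt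
    · rwa [← val_trim]
    · rwa [← icost_trim, ← icost_trim]

end NDA

namespace NDA

/-! ### Computing with tables -/

/-- The weight of a transition according to the table. -/
def codeTrans (c : Code) (p σ q : ℕ) : Option ℕ :=
  ((c.2.2.2.2.2[p]?.bind fun t => t[σ]?).bind fun t => t[q]?).bind id

/-- The final weight of a state according to the table. -/
def codeFinal (c : Code) (q : ℕ) : Option ℕ := c.2.2.2.2.1[q]?.bind id

/-- The initial states, each with the cost `0`. -/
def codeStart (c : Code) : List (ℕ × ℕ) :=
  (List.range c.2.1).filterMap fun q => if c.2.2.2.1[q]? = some true then some (q, 0) else none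

/-- All extensions by the letter `σ` of the runs whose final states and scaled weights are listed
in `R`. -/
def codeStep (c : Code) (R : List (ℕ × ℕ)) (σ : ℕ) : List (ℕ × ℕ) :=
  R.flatMap fun x => (List.range c.2.1).filterMap fun q =>
    (codeTrans c x.1 σ q).map fun k => (q, c.2.2.1 * (x.2 + k))

/-- All extensions by the word `w` of the runs listed in `R`. -/
def codeRuns (c : Code) (R : List (ℕ × ℕ)) (w : List ℕ) : List (ℕ × ℕ) := w.foldl (codeStep c) R

/-- The weights, with the final weights, of the accepting runs listed in `R`. -/
def codeCosts (c : Code) (R : List (ℕ × ℕ)) : List ℕ :=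
  R.filterMap fun x => (codeFinal c x.1).map fun k => x.2 + k

/-- The words of length at most `W` over the letters `0, …, k - 1`. -/
def words (k W : ℕ) : List (List ℕ) :=
  Nat.rec [[]] (fun _ L => [] :: L.flatMap fun w => (List.range k).map fun σ => σ :: w) W

/-- Whether `HasGapWithin` holds at the given words, according to the table. -/
def CodeGapAt (c : Code) (X : ℕ) (w z z' : List ℕ) : Prop :=
  ∃ x ∈ codeRuns c (codeStart c) w, ∃ y ∈ codeRuns c (codeStart c) w, y.2 + X < x.2 ∧
    codeCosts c (codeRuns c [y] z') ≠ [] ∧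
    ∃ e ∈ codeCosts c (codeRuns c [x] z),
      ∀ e' ∈ codeCosts c (codeRuns c (codeStart c) (w ++ z)), e ≤ e'

/-- The separation bound for automata with parameters at most `G`. -/
def gapBound (G : ℕ) : ℕ := G ^ (G ^ 2 * 2 ^ (G ^ 2)) * (4 * (G * G))

/-- The length bound for automata with parameters at most `G`. -/
def lengthBound (G : ℕ) : ℕ := (gapBound G + 2 * G + 2) ^ G + 2 ^ G

/-- A bound on the number of states, the discount factor and the weights: the Gödel number of the
table. -/
def tableBound (c : Code) : ℕ := Encodable.encode c

/-- Whether `HasGapWithin` holds for the computed bounds, according to the table. -/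
def CodeGap (c : Code) : Prop :=
  ∃ w ∈ words c.1 (lengthBound (tableBound c)), ∃ z ∈ words c.1 (lengthBound (tableBound c)),
    ∃ z' ∈ words c.1 (lengthBound (tableBound c)), CodeGapAt c (gapBound (tableBound c)) w z z'

/-! ### The computation is primitive recursive -/

section primrec

open Primrec

theorem primrec_tableBound : Primrec tableBound := Primrec.encode

theorem primrec_pow : Primrec₂ ((· ^ ·) : ℕ → ℕ → ℕ) :=
  Primrec₂.unpaired'.1 Nat.Primrec.pow

theorem primrecPred_exists_mem {α β : Type*} [Primcodable α] [Primcodable β] {f : α → List β}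
    {p : α → β → Prop} (hf : Primrec f) (hp : PrimrecRel p) :
    PrimrecPred fun a => ∃ b ∈ f a, p a b := by
  have h : PrimrecRel fun (b : β) (a : α) => p a b := PrimrecRel.comp hp snd fst
  exact h.exists_mem_list.comp hf Primrec.id

theorem primrecPred_forall_mem {α β : Type*} [Primcodable α] [Primcodable β] {f : α → List β}
    {p : α → β → Prop} (hf : Primrec f) (hp : PrimrecRel p) :
    PrimrecPred fun a => ∀ b ∈ f a, p a b := by
  have h : PrimrecRel fun (b : β) (a : α) => p a b := PrimrecRel.comp hp snd fst
  exact h.forall_mem_list.comp hf Primrec.id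

variable {α : Type*} [Primcodable α] {c : α → Code}

theorem primrec_codeTrans {p σ q : α → ℕ} (hc : Primrec c) (hp : Primrec p) (hσ : Primrec σ)
    (hq : Primrec q) : Primrec fun a => codeTrans (c a) (p a) (σ a) (q a) := by
  have hT : Primrec fun a => (c a).2.2.2.2.2 :=
    snd.comp (snd.comp (snd.comp (snd.comp (snd.comp hc))))
  exact option_bind (option_bind (option_bind (list_getElem?.comp hT hp)
    (list_getElem?.comp snd (hσ.comp fst))) (list_getElem?.comp snd (hq.comp fst))) snd

theorem primrec_codeFinal {q : α → ℕ} (hc : Primrec c) (hq : Primrec q) :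
    Primrec fun a => codeFinal (c a) (q a) :=
  option_bind (list_getElem?.comp
    (fst.comp (snd.comp (snd.comp (snd.comp (snd.comp hc))))) hq) snd

theorem primrec_codeStart (hc : Primrec c) : Primrec fun a => codeStart (c a) := by
  have hn : Primrec fun a => (c a).2.1 := fst.comp (snd.comp hc)
  have hi : Primrec fun a => (c a).2.2.2.1 := fst.comp (snd.comp (snd.comp (snd.comp hc)))
  exact listFilterMap (list_range.comp hn)
    (Primrec.ite (Primrec.eq.comp (list_getElem?.comp (hi.comp fst) snd) (const (some true)))
      (option_some.comp (snd.pair (const 0))) (const none))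

theorem primrec_codeStep {R : α → List (ℕ × ℕ)} {σ : α → ℕ} (hc : Primrec c) (hR : Primrec R)
    (hσ : Primrec σ) : Primrec fun a => codeStep (c a) (R a) (σ a) := by
  have hn : Primrec fun a => (c a).2.1 := fst.comp (snd.comp hc)
  have hl : Primrec fun a => (c a).2.2.1 := fst.comp (snd.comp (snd.comp hc))
  refine list_flatMap hR (listFilterMap (list_range.comp (hn.comp fst)) ?_)
  refine option_map (primrec_codeTrans (hc.comp (fst.comp fst)) (fst.comp (snd.comp fst))
    (hσ.comp (fst.comp fst)) snd) ?_
  exact (snd.comp fst).pair (nat_mul.comp (hl.comp (fst.comp (fst.comp fst)))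
    (nat_add.comp (snd.comp (snd.comp (fst.comp fst))) snd))

theorem primrec_codeRuns {R : α → List (ℕ × ℕ)} {w : α → List ℕ} (hc : Primrec c)
    (hR : Primrec R) (hw : Primrec w) : Primrec fun a => codeRuns (c a) (R a) (w a) :=
  list_foldl hw hR (primrec_codeStep (hc.comp fst) (fst.comp snd) (snd.comp snd)).to₂

theorem primrec_codeCosts {R : α → List (ℕ × ℕ)} (hc : Primrec c) (hR : Primrec R) :
    Primrec fun a => codeCosts (c a) (R a) :=
  listFilterMap hR (option_map (primrec_codeFinal (hc.comp fst) (fst.comp snd))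
    (nat_add.comp (snd.comp (snd.comp fst)) snd))

theorem primrec_words {k W : α → ℕ} (hk : Primrec k) (hW : Primrec W) :
    Primrec fun a => words (k a) (W a) := by
  refine nat_rec' (β := List (List ℕ)) (h := fun a p => [] :: p.2.flatMap fun w =>
    (List.range (k a)).map fun σ => σ :: w) hW (const [[]]) ?_
  refine list_cons.comp (const []) (list_flatMap (snd.comp snd) ?_)
  exact list_map (list_range.comp (hk.comp (fst.comp fst)))
    (list_cons.comp snd (snd.comp fst)).to₂

theorem primrec_gapBound : Primrec gapBound := by
  have h2 : Primrec fun G : ℕ => G ^ 2 := primrec_pow.comp Primrec.id (const 2)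
  exact nat_mul.comp (primrec_pow.comp Primrec.id (nat_mul.comp h2 (primrec_pow.comp (const 2) h2)))
    (nat_mul.comp (const 4) (nat_mul.comp Primrec.id Primrec.id))

theorem primrec_lengthBound : Primrec lengthBound :=
  nat_add.comp (primrec_pow.comp (nat_add.comp (nat_add.comp primrec_gapBound
    (nat_mul.comp (const 2) Primrec.id)) (const 2)) Primrec.id)
    (primrec_pow.comp (const 2) Primrec.id)

theorem primrecPred_codeGapAt {X : α → ℕ} {w z z' : α → List ℕ} (hc : Primrec c)
    (hX : Primrec X) (hw : Primrec w) (hz : Primrec z) (hz' : Primrec z') :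
    PrimrecPred fun a => CodeGapAt (c a) (X a) (w a) (z a) (z' a) := by
  have hruns : Primrec fun a => codeRuns (c a) (codeStart (c a)) (w a) :=
    primrec_codeRuns hc (primrec_codeStart hc) hw
  have hone : ∀ {γ : Type _} [Primcodable γ] {f : γ → ℕ × ℕ}, Primrec f →
      Primrec fun a => [f a] := fun hf => list_cons.comp hf (const [])
  refine primrecPred_exists_mem hruns (primrecPred_exists_mem (hruns.comp fst) ?_)
  refine PrimrecPred.and (nat_lt.comp (nat_add.comp (snd.comp snd) (hX.comp (fst.comp fst)))
    (snd.comp (snd.comp fst))) (PrimrecPred.and ?_ ?_)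
  · have h1 : Primrec fun b : (α × (ℕ × ℕ)) × (ℕ × ℕ) =>
        codeCosts (c b.1.1) (codeRuns (c b.1.1) [b.2] (z' b.1.1)) :=
      primrec_codeCosts (hc.comp (fst.comp fst))
        (primrec_codeRuns (hc.comp (fst.comp fst)) (hone snd) (hz'.comp (fst.comp fst)))
    exact (Primrec.eq.comp h1 (const [])).not
  · refine primrecPred_exists_mem ?_ (primrecPred_forall_mem ?_ ?_)
    · exact primrec_codeCosts (hc.comp (fst.comp fst)) (primrec_codeRuns (hc.comp (fst.comp fst))
        (hone (snd.comp fst)) (hz.comp (fst.comp fst)))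
    · have h1 : Primrec fun a => codeCosts (c a) (codeRuns (c a) (codeStart (c a)) (w a ++ z a)) :=
        primrec_codeCosts hc (primrec_codeRuns hc (primrec_codeStart hc) (list_append.comp hw hz))
      exact h1.comp (fst.comp (fst.comp fst))
    · exact nat_le.comp (snd.comp fst) snd

theorem primrecPred_codeGap : PrimrecPred CodeGap := by
  have hW : Primrec fun c : Code => words c.1 (lengthBound (tableBound c)) :=
    primrec_words fst (primrec_lengthBound.comp primrec_tableBound)
  refine primrecPred_exists_mem hW (primrecPred_exists_mem (hW.comp fst)
    (primrecPred_exists_mem (hW.comp (fst.comp fst)) ?_))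
  exact primrecPred_codeGapAt (fst.comp (fst.comp fst))
    ((primrec_gapBound.comp primrec_tableBound).comp (fst.comp (fst.comp fst)))
    (snd.comp (fst.comp fst)) (snd.comp fst) snd

end primrec

/-! ### Correctness of the computation -/

theorem mem_words {k W : ℕ} {w : List ℕ} :
    w ∈ words k W ↔ w.length ≤ W ∧ ∀ σ ∈ w, σ < k := by
  induction W generalizing w with
  | zero =>
    change w ∈ [[]] ↔ _
    simp only [List.mem_singleton, Nat.le_zero, List.length_eq_zero_iff]
    constructor
    · rintro rfl
      simp
    · exact fun h => h.1
  | succ W ih =>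
    change w ∈ [] :: (words k W).flatMap _ ↔ _
    cases w with
    | nil => simp
    | cons σ w =>
      simp only [List.mem_cons, reduceCtorEq, false_or, List.mem_flatMap, List.mem_map,
        List.mem_range, List.cons.injEq, ih, List.length_cons, add_le_add_iff_right]
      constructor
      · rintro ⟨w', ⟨h1, h2⟩, σ', h3, rfl, rfl⟩
        refine ⟨h1, ?_⟩
        rintro τ (rfl | hτ)
        exacts [h3, h2 τ hτ]
      · rintro ⟨h1, h2⟩
        exact ⟨w, ⟨h1, fun τ hτ => h2 τ (Or.inr hτ)⟩, σ, h2 σ (Or.inl rfl), rfl, rfl⟩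

theorem exists_map_val_of_lt {k : ℕ} {w : List ℕ} (h : ∀ σ ∈ w, σ < k) :
    ∃ v : List (Fin k), v.map Fin.val = w := by
  induction w with
  | nil => exact ⟨[], rfl⟩
  | cons σ w ih =>
    obtain ⟨v, hv⟩ := ih fun τ hτ => h τ (List.mem_cons_of_mem _ hτ)
    exact ⟨⟨σ, h σ List.mem_cons_self⟩ :: v, by simp [hv]⟩

theorem exists_mem_words_iff {k W : ℕ} {p : List ℕ → Prop} :
    (∃ w ∈ words k W, p w) ↔ ∃ v : List (Fin k), v.length ≤ W ∧ p (v.map Fin.val) := by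
  simp only [mem_words]
  constructor
  · rintro ⟨w, ⟨h1, h2⟩, h3⟩
    obtain ⟨v, rfl⟩ := exists_map_val_of_lt h2
    exact ⟨v, by simpa using h1, h3⟩
  · rintro ⟨v, h1, h2⟩
    refine ⟨_, ⟨by simpa using h1, ?_⟩, h2⟩
    intro σ hσ
    obtain ⟨τ, -, rfl⟩ := List.mem_map.1 hσ
    exact τ.2

section correct

variable {k n : ℕ} (A : NDA (Fin k) (Fin n))

theorem codeTrans_encode (p : Fin n) (σ : Fin k) (q : Fin n) :
    codeTrans A.encode p σ q = A.trans p σ q := by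
  simp [codeTrans, NDA.encode]

theorem codeFinal_encode (q : Fin n) : codeFinal A.encode q = A.final q := by
  simp [codeFinal, NDA.encode]

/-- The list `R` of pairs of states and numbers represents the cost vector `d`: its numbers are
upper bounds, and every finite cost occurs. -/
def Represents (R : List (ℕ × ℕ)) (d : Fin n → ℕ∞) : Prop :=
  (∀ x ∈ R, ∃ q : Fin n, x.1 = q ∧ d q ≤ x.2) ∧ ∀ (q : Fin n) (e : ℕ), d q = e → ((q : ℕ), e) ∈ R

theorem represents_start : Represents (codeStart A.encode) (ind A.init) := by
  constructor
  · intro x hx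
    obtain ⟨q, hq, h⟩ := List.mem_filterMap.1 hx
    have hq' : q < n := List.mem_range.1 hq
    split_ifs at h with hi
    obtain rfl := Option.some.inj h
    have : (⟨q, hq'⟩ : Fin n) ∈ A.init := by simpa [NDA.encode, hq'] using hi
    exact ⟨⟨q, hq'⟩, rfl, by simp [this]⟩
  · intro q e hqe
    have hq : q ∈ A.init := ind_ne_top.1 (hqe.trans_ne (ENat.natCast_ne_top e))
    rw [ind_of_mem hq] at hqe
    obtain rfl : e = 0 := by exact_mod_cast hqe.symm
    refine List.mem_filterMap.2 ⟨q, List.mem_range.2 q.2, ?_⟩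
    rw [if_pos]
    simpa [NDA.encode] using hq

theorem represents_singleton (q : Fin n) (e : ℕ) :
    Represents [((q : ℕ), e)] fun p => e + ind {q} p := by
  constructor
  · intro x hx
    obtain rfl := List.mem_singleton.1 hx
    exact ⟨q, rfl, by simp⟩
  · intro p e' h
    have hp : p ∈ ({q} : Set (Fin n)) :=
      ind_ne_top.1 (not_or.1 (ENat.add_eq_top.not.1 (h.trans_ne (ENat.natCast_ne_top e')))).2
    simp only [ind_of_mem hp, add_zero] at h
    obtain rfl : e = e' := by exact_mod_cast h
    rw [Set.mem_singleton_iff.1 hp]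
    exact List.mem_singleton_self _

theorem represents_step {R : List (ℕ × ℕ)} {d : Fin n → ℕ∞} (h : Represents R d) (σ : Fin k) :
    Represents (codeStep A.encode R σ) (A.step d σ) := by
  constructor
  · intro y hy
    obtain ⟨x, hx, hy⟩ := List.mem_flatMap.1 hy
    obtain ⟨q, hq, hy⟩ := List.mem_filterMap.1 hy
    have hq' : q < n := List.mem_range.1 hq
    obtain ⟨e, he, rfl⟩ := Option.map_eq_some_iff.1 hy
    obtain ⟨p, hp, hd⟩ := h.1 x hx
    refine ⟨⟨q, hq'⟩, rfl, ?_⟩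
    have he' : A.trans p σ ⟨q, hq'⟩ = some e := by
      rw [← codeTrans_encode, ← hp]
      exact he
    refine (iInf_le _ p).trans ?_
    rw [he', optCost_some]
    change _ ≤ ((A.lam * (x.2 + e) : ℕ) : ℕ∞)
    push_cast
    gcongr
  · intro q e hqe
    obtain ⟨p, hp⟩ := exists_eq_of_iInf_ne_top (hqe.trans_ne (ENat.natCast_ne_top e))
    have hp' : (A.lam : ℕ∞) ^ 1 * (d p + optCost (A.trans p σ q)) + 0 = e := by
      rw [pow_one, add_zero, hp]
      exact hqe
    obtain ⟨s, t, h1, h2, h3⟩ := A.mul_pow_add_eq_coe.1 hp'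
    obtain ⟨ha, hb⟩ := not_or.1 (ENat.add_eq_top.not.1 (h1.trans_ne (ENat.natCast_ne_top s)))
    obtain ⟨a, ha⟩ := lift_nat ha
    obtain ⟨b, hb⟩ := lift_nat hb
    have hs : a + b = s := by
      rw [ha, hb] at h1
      exact_mod_cast h1
    have ht : t = 0 := by exact_mod_cast h2.symm
    refine List.mem_flatMap.2 ⟨_, h.2 p a ha, List.mem_filterMap.2 ⟨q, List.mem_range.2 q.2, ?_⟩⟩
    refine Option.map_eq_some_iff.2 ⟨b, ?_, ?_⟩
    · rw [codeTrans_encode]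
      exact optCost_eq_coe.1 hb
    · change ((q : ℕ), A.lam * (a + b)) = _
      rw [hs, ← h3, ht, pow_one, add_zero]

theorem represents_runs {R : List (ℕ × ℕ)} {d : Fin n → ℕ∞} (h : Represents R d)
    (w : List (Fin k)) : Represents (codeRuns A.encode R (w.map Fin.val)) (A.cost d w) := by
  induction w generalizing R d with
  | nil => exact h
  | cons σ w ih => exact ih (A.represents_step h σ)

theorem iInf_le_of_mem_codeCosts {R : List (ℕ × ℕ)} {d : Fin n → ℕ∞} (h : Represents R d) {e : ℕ}
    (he : e ∈ codeCosts A.encode R) : ⨅ q, d q + optCost (A.final q) ≤ e := by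
  obtain ⟨x, hx, he⟩ := List.mem_filterMap.1 he
  obtain ⟨f, hf, rfl⟩ := Option.map_eq_some_iff.1 he
  obtain ⟨q, hq, hd⟩ := h.1 x hx
  refine (iInf_le _ q).trans ?_
  rw [hq, codeFinal_encode] at hf
  rw [hf, optCost_some]
  push_cast
  gcongr

theorem mem_codeCosts {R : List (ℕ × ℕ)} {d : Fin n → ℕ∞} (h : Represents R d) {e : ℕ}
    (he : ⨅ q, d q + optCost (A.final q) = e) : e ∈ codeCosts A.encode R := by
  obtain ⟨q, hq⟩ := exists_eq_of_iInf_ne_top (he.trans_ne (ENat.natCast_ne_top e))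
  rw [he] at hq
  obtain ⟨ha, hb⟩ := not_or.1 (ENat.add_eq_top.not.1 (hq.trans_ne (ENat.natCast_ne_top e)))
  obtain ⟨a, ha⟩ := lift_nat ha
  obtain ⟨b, hb⟩ := lift_nat hb
  have hs : a + b = e := by
    rw [ha, hb] at hq
    exact_mod_cast hq
  refine List.mem_filterMap.2 ⟨_, h.2 q a ha, Option.map_eq_some_iff.2 ⟨b, ?_, hs⟩⟩
  rw [codeFinal_encode]
  exact optCost_eq_coe.1 hb

theorem iInf_cost_add_final (d : Fin n → ℕ∞) (z : List (Fin k)) :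
    ⨅ q, A.cost d z q + optCost (A.final q) =
      ⨅ p, (A.lam : ℕ∞) ^ z.length * d p + A.tail z p := by
  simpa [tail] using A.iInf_cost_add_tail d z []

theorem iInf_cost_singleton_add_final (q : Fin n) (e : ℕ) (z : List (Fin k)) :
    ⨅ p, A.cost (fun p => e + ind {q} p) z p + optCost (A.final p) =
      (A.lam : ℕ∞) ^ z.length * e + A.tail z q := by
  rw [iInf_cost_add_final]
  simp only [mul_add, mul_ind _ _ (A.lam_pow_ne_zero _), add_assoc, ← ENat.add_iInf,
    iInf_ind_singleton_add]

theorem iInf_icost_add_final (w : List (Fin k)) :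
    ⨅ p, A.cost (ind A.init) w p + optCost (A.final p) = A.val w := by
  simpa [tail, icost] using A.iInf_icost_add_tail w []

/-- Each listed number is the weight of a run, and all minimal weights are listed, so that comparing
listed numbers decides optimality. -/
theorem codeGapAt_encode_iff {X : ℕ} {w z z' : List (Fin k)} :
    CodeGapAt A.encode X (w.map Fin.val) (z.map Fin.val) (z'.map Fin.val) ↔
      ∃ q l : Fin n, (A.lam : ℕ∞) ^ z.length * A.icost w q + A.tail z q = A.val (w ++ z) ∧
        A.val (w ++ z) ≠ ⊤ ∧ A.icost w l + X < A.icost w q ∧ l ∈ A.accepting z' := by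
  have hw := A.represents_runs A.represents_start w
  have hwz := A.represents_runs A.represents_start (w ++ z)
  rw [List.map_append] at hwz
  constructor
  · rintro ⟨⟨x, a⟩, hx, ⟨y, b⟩, hy, hlt, hne, e, he, hmin⟩
    obtain ⟨q, rfl, ha⟩ := hw.1 _ hx
    obtain ⟨l, rfl, hb⟩ := hw.1 _ hy
    have hle := A.iInf_le_of_mem_codeCosts (A.represents_runs (represents_singleton q a) z) he
    rw [iInf_cost_singleton_add_final] at hle
    have h1 : A.val (w ++ z) ≤ (A.lam : ℕ∞) ^ z.length * A.icost w q + A.tail z q :=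
      A.val_le w z q
    have h2 : (A.lam : ℕ∞) ^ z.length * A.icost w q + A.tail z q ≤
        (A.lam : ℕ∞) ^ z.length * a + A.tail z q := by
      gcongr
      exact ha
    have hvt : A.val (w ++ z) ≠ ⊤ :=
      ne_top_of_le_ne_top (ENat.natCast_ne_top e) (h1.trans (h2.trans hle))
    have hev : (e : ℕ∞) ≤ A.val (w ++ z) := by
      obtain ⟨v, hv⟩ := lift_nat hvt
      rw [hv]
      rw [← iInf_icost_add_final] at hv
      exact_mod_cast hmin v (A.mem_codeCosts hwz hv)
    have h3 : (A.lam : ℕ∞) ^ z.length * A.icost w q + A.tail z q = A.val (w ++ z) :=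
      le_antisymm (h2.trans (hle.trans hev)) h1
    have h4 : (A.lam : ℕ∞) ^ z.length * a + A.tail z q = A.val (w ++ z) :=
      le_antisymm (hle.trans hev) (h1.trans h2)
    have hq : A.icost w q = a := A.eq_of_mul_pow_add_eq (h3.trans h4.symm) (h4.trans_ne hvt)
    refine ⟨q, l, h3, hvt, ?_, ?_⟩
    · rw [hq]
      refine lt_of_le_of_lt (add_le_add hb le_rfl) ?_
      exact_mod_cast hlt
    · obtain ⟨f, hf⟩ := List.exists_mem_of_ne_nil _ hne
      have := A.iInf_le_of_mem_codeCosts (A.represents_runs (represents_singleton l b) z') hf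
      rw [iInf_cost_singleton_add_final] at this
      exact (A.mul_pow_add_ne_top.1 (ne_top_of_le_ne_top (ENat.natCast_ne_top f) this)).2
  · rintro ⟨q, l, hopt, hne, hgap, hl⟩
    obtain ⟨a, ha⟩ := lift_nat (A.mul_pow_add_ne_top.1 (hopt.trans_ne hne)).1
    obtain ⟨b, hb⟩ := lift_nat (ne_top_of_lt (le_self_add.trans_lt hgap))
    obtain ⟨e, he⟩ := lift_nat hne
    rw [ha, hb] at hgap
    refine ⟨_, hw.2 q a ha, _, hw.2 l b hb, by exact_mod_cast hgap, ?_, e, ?_, fun e' he' => ?_⟩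
    · obtain ⟨f, hf⟩ := lift_nat (A.mul_pow_add_ne_top (n := z'.length) (a := (b : ℕ∞)).2
        ⟨ENat.natCast_ne_top b, hl⟩)
      rw [← iInf_cost_singleton_add_final] at hf
      exact List.ne_nil_of_mem
        (A.mem_codeCosts (A.represents_runs (represents_singleton l b) z') hf)
    · refine A.mem_codeCosts (A.represents_runs (represents_singleton q a) z) ?_
      rw [iInf_cost_singleton_add_final, ← ha, hopt, he]
    · have := A.iInf_le_of_mem_codeCosts hwz he'
      rw [iInf_icost_add_final, he] at this
      exact_mod_cast this

theorem codeGap_encode_iff : CodeGap A.encode ↔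
    A.HasGapWithin (gapBound (tableBound A.encode)) (lengthBound (tableBound A.encode)) := by
  have h0 : A.encode.1 = k := rfl
  rw [CodeGap, h0, exists_mem_words_iff, HasGapWithin]
  refine exists_congr fun w => ?_
  rw [exists_mem_words_iff, ← exists_and_left]
  refine exists_congr fun z => ?_
  rw [exists_mem_words_iff, ← exists_and_left, ← exists_and_left]
  refine exists_congr fun z' => ?_
  rw [codeGapAt_encode_iff]

/-! ### The bounds -/

theorem encode_le_of_mem {α : Type*} [Encodable α] {a : α} {l : List α} (h : a ∈ l) :
    Encodable.encode a ≤ Encodable.encode l := by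
  induction l with
  | nil => simp at h
  | cons b l ih =>
    rw [Encodable.encode_list_cons]
    rcases List.mem_cons.1 h with rfl | h
    · exact (Nat.left_le_pair _ _).trans (Nat.le_succ _)
    · exact (ih h).trans ((Nat.right_le_pair _ _).trans (Nat.le_succ _))

theorem encode_fst_le {α β : Type*} [Encodable α] [Encodable β] (x : α × β) :
    Encodable.encode x.1 ≤ Encodable.encode x := Nat.left_le_pair _ _

theorem encode_snd_le {α β : Type*} [Encodable α] [Encodable β] (x : α × β) :
    Encodable.encode x.2 ≤ Encodable.encode x := Nat.right_le_pair _ _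

theorem card_le_tableBound : n ≤ tableBound A.encode :=
  (encode_fst_le A.encode.2).trans (encode_snd_le A.encode)

theorem encode_snd_snd_le : Encodable.encode A.encode.2.2 ≤ tableBound A.encode :=
  (encode_snd_le A.encode.2).trans (encode_snd_le A.encode)

theorem lam_le_tableBound : A.lam ≤ tableBound A.encode :=
  (encode_fst_le A.encode.2.2).trans A.encode_snd_snd_le

theorem encode_weights_le : Encodable.encode A.encode.2.2.2.2 ≤ tableBound A.encode :=
  (encode_snd_le A.encode.2.2.2).trans ((encode_snd_le A.encode.2.2).trans A.encode_snd_snd_le)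

theorem le_encode_some (c : ℕ) : c ≤ Encodable.encode (some c) := by
  rw [Encodable.encode_some]
  exact Nat.le_succ c

theorem maxWeight_le_tableBound : A.maxWeight ≤ tableBound A.encode := by
  refine csSup_le' ?_
  rintro c (⟨p, σ, q, h⟩ | ⟨q, h⟩)
  · calc c ≤ Encodable.encode (A.trans p σ q) := h ▸ le_encode_some c
      _ ≤ Encodable.encode (List.ofFn fun q => A.trans p σ q) :=
        encode_le_of_mem (List.mem_ofFn.2 ⟨q, rfl⟩)
      _ ≤ Encodable.encode (List.ofFn fun σ => List.ofFn fun q => A.trans p σ q) :=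
        encode_le_of_mem (List.mem_ofFn.2 ⟨σ, rfl⟩)
      _ ≤ Encodable.encode
          (List.ofFn fun p => List.ofFn fun σ => List.ofFn fun q => A.trans p σ q) :=
        encode_le_of_mem (List.mem_ofFn.2 ⟨p, rfl⟩)
      _ ≤ Encodable.encode A.encode.2.2.2.2 := encode_snd_le A.encode.2.2.2.2
      _ ≤ tableBound A.encode := A.encode_weights_le
  · calc c ≤ Encodable.encode (A.final q) := h ▸ le_encode_some c
      _ ≤ Encodable.encode (List.ofFn fun q => A.final q) :=
        encode_le_of_mem (List.mem_ofFn.2 ⟨q, rfl⟩)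
      _ ≤ Encodable.encode A.encode.2.2.2.2 := encode_fst_le A.encode.2.2.2.2
      _ ≤ tableBound A.encode := A.encode_weights_le

theorem constN_le_gapBound : A.constN ≤ gapBound (tableBound A.encode) := by
  have h1 := A.card_le_tableBound
  have h2 := A.lam_le_tableBound
  have h3 := A.maxWeight_le_tableBound
  have h4 : 1 ≤ tableBound A.encode := A.one_lt_lam.le.trans h2
  generalize tableBound A.encode = G at *
  have h5 : A.lam ^ (n ^ 2 * 2 ^ (n ^ 2)) * (4 * (n * A.maxWeight)) ≤ gapBound G := by
    unfold gapBound
    gcongr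
    norm_num
  have h6 : (A.lam : ℝ) ^ (n ^ 2 * 2 ^ (n ^ 2)) * (4 * (n * A.maxWeight)) ≤ gapBound G := by
    exact_mod_cast h5
  have h7 := A.runBound_le
  have h8 : (A.lam : ℝ) ^ (n ^ 2 * 2 ^ (n ^ 2)) * (2 * (n * A.runBound)) ≤
      (A.lam : ℝ) ^ (n ^ 2 * 2 ^ (n ^ 2)) * (2 * (n * (2 * A.maxWeight))) := by gcongr
  rw [constN_eq, Nat.card_fin]
  have h9 := A.runBound_nonneg
  linarith

theorem determinizable_iff_not_codeGap : A.Determinizable ↔ ¬ CodeGap A.encode := by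
  rw [codeGap_encode_iff]
  have h1 := A.card_le_tableBound
  refine A.determinizable_iff_not_hasGapWithin A.maxWeight_le_tableBound A.constN_le_gapBound ?_ ?_
  · rw [Nat.card_fin]
    exact (Nat.pow_le_pow_right (by omega) h1).trans (Nat.le_add_right _ _)
  · rw [Nat.card_fin]
    exact (Nat.pow_le_pow_right (by omega) h1).trans (Nat.le_add_left _ _)

end correct

open Classical in
theorem exists_computable_iff_determinizable : ∃ f : NDA.Code → Bool, Computable f ∧
    ∀ (k n : ℕ) (A : NDA (Fin k) (Fin n)), f A.encode = true ↔ A.Determinizable := by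
  refine ⟨fun c => decide (¬ CodeGap c), (primrecPred_codeGap.not.decide).to_comp, ?_⟩
  intro k n A
  rw [decide_eq_true_iff, determinizable_iff_not_codeGap]

end NDA

theorem mainTheorem1 :
    -- determinizability is decidable
    (∃ f : NDA.Code → Bool, Computable f ∧
      ∀ (k n : ℕ) (A : NDA (Fin k) (Fin n)), f A.encode = true ↔ A.Determinizable) ∧
    -- the characterization behind the decision procedure
    (∀ (S : Type*) (Q : Type*) [Finite S] [Finite Q] (A : NDA S Q),
      A.shortPairs.Finite ∧
      ((∀ q, A.Reachable q → A.CoReachable q) →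
        (A.Determinizable ↔ ¬ A.HasShortSeparation)) ∧
      (¬ A.HasShortSeparation → A.Determinizable) ∧
      (A.Determinizable ↔ ¬ A.trim.HasShortSeparation) ∧
      (A.Determinizable ↔ A.DeterminizableWith A.lam)) := by
  refine ⟨NDA.exists_computable_iff_determinizable, fun S Q _ _ A => ⟨A.finite_shortPairs,
    A.determinizable_iff,
    fun h => (A.determinizableWith_of_not_hasShortSeparation h).determinizable,
    A.determinizable_iff_trim, A.determinizable_iff_determinizableWith⟩⟩
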